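/- Let $\zeta$ be the Riemann zeta function. The integral $$I=\int_0^\infty \frac{t\,\ln\left|\zeta(\tfrac12+it)\,(-\tfrac12+it)\right|}{(t^2+\tfrac14)^2}\,dt$$ converges absolutely, and the Cauchy principal value $$P=\mathrm{P.V.}\int_{1/2}^\infty \frac{(x-\tfrac12)\,\ln\left|\zeta(x)(x-1)\right|}{x^2(x-1)^2}\,dx :=\lim_{\varepsilon\to0^+}\left(\int_{1/2}^{1-\varepsilon}+\int_{1+\varepsilon}^{\infty}\right)\frac{(x-\tfrac12)\,\ln\left|\zeta(x)(x-1)\right|}{x^2(x-1)^2}\,dx$$ exists as a finite limit, the integrals over $(1/2,1-\varepsilon)$ and $(1+\varepsilon,\infty)$ being absolutely convergent. The equality $$-I=P$$ holds if and only if the Riemann hypothesis is true. -/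

import Mathlib

open MeasureTheory Set Filter Topology

noncomputable section

/-- The integrand on the critical line, `t * ln |ζ(1/2 + it) (-1/2 + it)| / (t² + 1/4)²`. -/
def criticalLineIntegrand (t : ℝ) : ℝ :=
  t * Real.log ‖riemannZeta (1 / 2 + (t : ℂ) * Complex.I) * (-1 / 2 + (t : ℂ) * Complex.I)‖ /
    (t ^ 2 + 1 / 4) ^ 2

/-- The integrand on the real axis, `(x - 1/2) * ln |ζ(x) (x - 1)| / (x² (x - 1)²)`. -/
def realAxisIntegrand (x : ℝ) : ℝ :=
  (x - 1 / 2) * Real.log ‖riemannZeta (x : ℂ) * ((x : ℂ) - 1)‖ / (x ^ 2 * (x - 1) ^ 2)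

/-- The Cauchy principal value of `∫ f` over `(a, ∞)`, with a singularity at `c > a`, exists and
equals `L`: `f` is integrable away from `c`, and the integrals over `(a, c - ε)` and `(c + ε, ∞)`
add up to a quantity that tends to `L` as `ε → 0⁺`. -/
def HasPrincipalValueIoi (f : ℝ → ℝ) (a c L : ℝ) : Prop :=
  (∀ ε : ℝ, 0 < ε → IntegrableOn f (Ioo a (c - ε)) ∧ IntegrableOn f (Ioi (c + ε))) ∧
    Tendsto (fun ε : ℝ => (∫ x in Ioo a (c - ε), f x) + ∫ x in Ioi (c + ε), f x)
      (𝓝[>] 0) (𝓝 L)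

end

/-! Write `F(s) = (s - 1) ζ(s)`, the entire function `riemannZeta₁`, and `w = s (s - 1)`, `v = w +
1/4 = (s - 1/2)²`. The map `s ↦ v` sends the quadrant `Re s > 1/2`, `Im s > 0` onto the upper
half-plane; the critical line becomes `w < -1/4` and the real ray `s > 1/2` becomes `w > -1/4`.
Under this substitution `I` and `P` are the two pieces of one integral, so that `I + P = (1/2) PV ∫
log|F| / w² dw` over the whole real line.

This integral is a limit of Poisson integrals. At `p = 1/4 + iη` in the `v`-plane, Poisson-Jensen
reads `(η/π) ∫ log|F| / (w² + η²) dw = log|F(p)| + Σ log|(q - p̄)/(q - p)|`, the sum being over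
zeros `q` of `F` in the open upper half-plane. Since `F = 1` at `w = 0`, `log|F| = γ Re w + O(|w|²)`
there, hence `log|F(p)| = O(η²)`. Dividing by `η` and letting `η → 0` kills that term, and the odd
term `γ w` does not contribute to the integral. A single zero contributes at least a positive
multiple of `η`, so the limit is positive if the Riemann hypothesis fails and is zero if it holds.
This is `integral_poleRemoved_eq_zero_iff`.

Only two forms of Poisson-Jensen are needed. The inequality `≥` with at most one zero
(`log_norm_quadrantZeta_add_le`) is unconditional: `F` is divided by the zero-free majorant `3 (s +
1)²`, and Jensen's formula on growing hyperbolic circles is combined with Fatou's lemma. Equality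
without zeros (`log_norm_quadrantZeta_eq_of_ne_zero`) is proved first on `Re s ≥ 1/2 + δ`, where
Borel-Carathéodory bounds `log|F|` from both sides, and then by `δ → 0`: zeros on the critical line
are only logarithmic singularities, and the tails are controlled by positivity. -/

/-! ### Hyperbolic circles in the upper half-plane -/

/-- The point of the upper half-plane with parameter `x` on the hyperbolic circle about `a + η I`
whose Euclidean radius in the disc model is `(1 - κ) / (1 + κ)`. -/
noncomputable def halfPlaneCircle (a η κ x : ℝ) : ℂ :=
  a + η * ((x + κ * Complex.I) / (1 - κ * x * Complex.I))

/-- The Cayley transform of the unit disc onto the upper half-plane, sending `0` to `a + η I`. -/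
noncomputable def discToHalfPlane (a η : ℝ) (ζ : ℂ) : ℂ :=
  a + η * Complex.I * ((1 + ζ) / (1 - ζ))

lemma one_sub_mul_I_ne_zero (x : ℝ) : (1 - x * Complex.I : ℂ) ≠ 0 := by
  intro h
  have := congrArg Complex.re h
  simp at this

lemma one_add_mul_I_ne_zero (x : ℝ) : (1 + x * Complex.I : ℂ) ≠ 0 := by
  intro h
  have := congrArg Complex.re h
  simp at this

lemma exp_two_arctan_mul_I (x : ℝ) :
    Complex.exp ((2 * Real.arctan x : ℝ) * Complex.I)
      = (1 + x * Complex.I) / (1 - x * Complex.I) := by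
  have h1 : Complex.exp ((Real.arctan x : ℝ) * Complex.I)
      = (1 + x * Complex.I) / (√(1 + x ^ 2) : ℝ) := by
    rw [Complex.exp_mul_I, ← Complex.ofReal_cos, ← Complex.ofReal_sin, Real.cos_arctan,
      Real.sin_arctan]
    push_cast
    ring
  have h2 : ((√(1 + x ^ 2) : ℝ) : ℂ) ^ 2 = (1 - x * Complex.I) * (1 + x * Complex.I) := by
    rw [← Complex.ofReal_pow, Real.sq_sqrt (by positivity)]
    push_cast
    ring_nf
    simp
  have h3 : ((2 * Real.arctan x : ℝ) * Complex.I : ℂ)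
      = (2 : ℕ) * ((Real.arctan x : ℝ) * Complex.I) := by push_cast; ring
  rw [h3, Complex.exp_nat_mul, h1, div_pow, h2]
  field_simp [one_sub_mul_I_ne_zero x, one_add_mul_I_ne_zero x]

lemma circleMap_two_arctan_add_pi (r x : ℝ) :
    circleMap 0 r (2 * Real.arctan x + Real.pi)
      = -r * ((1 + x * Complex.I) / (1 - x * Complex.I)) := by
  rw [circleMap, ← exp_two_arctan_mul_I, Complex.ofReal_add, add_mul, Complex.exp_add,
    Complex.exp_pi_mul_I]
  ring

lemma image_two_arctan_add_pi :
    (fun x => 2 * Real.arctan x + Real.pi) '' univ = Ioo 0 (2 * Real.pi) := by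
  have : (fun x => 2 * Real.arctan x + Real.pi)
      = (fun y => 2 * y + Real.pi) ∘ Real.arctan := rfl
  rw [this, image_comp, image_univ, Real.range_arctan]
  ext y
  simp only [mem_image, mem_Ioo]
  constructor
  · rintro ⟨z, ⟨h1, h2⟩, rfl⟩
    constructor <;> linarith
  · rintro ⟨h1, h2⟩
    exact ⟨(y - Real.pi) / 2, ⟨by linarith, by linarith⟩, by ring⟩

lemma hasDerivWithinAt_two_arctan_add_pi (x : ℝ) (s : Set ℝ) :
    HasDerivWithinAt (fun x => 2 * Real.arctan x + Real.pi) (2 * (1 + x ^ 2)⁻¹) s x :=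
  (((Real.hasDerivAt_arctan' x).const_mul 2).add_const _).hasDerivWithinAt

lemma injective_two_arctan_add_pi :
    Function.Injective (fun x => 2 * Real.arctan x + Real.pi) := fun x y h =>
  Real.arctan_injective (by simpa using h)

/-- The substitution `θ = 2 arctan x + π` turns `dθ / 2π` into `dx / (π (1 + x²))`. The shift by `π`
makes the omitted angle `θ = 0`, the direction that the Cayley transform sends to infinity. -/
lemma circleAverage_eq_integral_arctan (g : ℂ → ℝ) (r : ℝ) :
    Real.circleAverage g 0 r = Real.pi⁻¹ *
      ∫ x : ℝ, (1 + x ^ 2)⁻¹ * g (-r * ((1 + x * Complex.I) / (1 - x * Complex.I))) := by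
  rw [Real.circleAverage, intervalIntegral.integral_of_le (by positivity),
    integral_Ioc_eq_integral_Ioo, ← image_two_arctan_add_pi,
    integral_image_eq_integral_abs_deriv_smul MeasurableSet.univ
      (fun x _ => hasDerivWithinAt_two_arctan_add_pi x _) injective_two_arctan_add_pi.injOn]
  have : ∀ x : ℝ, |2 * (1 + x ^ 2)⁻¹| • g (circleMap 0 r (2 * Real.arctan x + Real.pi))
      = 2 * ((1 + x ^ 2)⁻¹ * g (-r * ((1 + x * Complex.I) / (1 - x * Complex.I)))) := by
    intro x
    rw [abs_of_pos (by positivity), circleMap_two_arctan_add_pi, smul_eq_mul]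
    ring
  simp only [this, Measure.restrict_univ, integral_const_mul, smul_eq_mul]
  rw [mul_inv]
  ring

lemma CircleIntegrable.integrable_arctan {g : ℂ → ℝ} {r : ℝ} (hg : CircleIntegrable g 0 r) :
    Integrable fun x : ℝ =>
      (1 + x ^ 2)⁻¹ * g (-r * ((1 + x * Complex.I) / (1 - x * Complex.I))) := by
  have h1 : IntegrableOn (fun θ => g (circleMap 0 r θ)) (Ioo 0 (2 * Real.pi)) :=
    ((intervalIntegrable_iff_integrableOn_Ioc_of_le (by positivity)).1 hg).mono_set
      Ioo_subset_Ioc_self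
  rw [← image_two_arctan_add_pi,
    integrableOn_image_iff_integrableOn_abs_deriv_smul MeasurableSet.univ
      (fun x _ => hasDerivWithinAt_two_arctan_add_pi x _) injective_two_arctan_add_pi.injOn,
    integrableOn_univ] at h1
  refine (h1.const_mul (1 / 2)).congr (Eventually.of_forall fun x => ?_)
  simp only
  rw [abs_of_pos (by positivity), circleMap_two_arctan_add_pi, smul_eq_mul]
  ring

/-- In this parametrization every circle carries the same weight `dx / (1 + x²)`, and for fixed `x`
the point tends to the real point `a + η x` as `κ → 0`. Limits of circle averages thus become limits
under one fixed integral. -/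
lemma discToHalfPlane_circle {a η κ : ℝ} (hκ : 0 ≤ κ) (x : ℝ) :
    discToHalfPlane a η (-((1 - κ) / (1 + κ) : ℝ) * ((1 + x * Complex.I) / (1 - x * Complex.I)))
      = halfPlaneCircle a η κ x := by
  have h1 : (1 + κ : ℂ) ≠ 0 := by
    rw [← Complex.ofReal_one, ← Complex.ofReal_add, Complex.ofReal_ne_zero]
    positivity
  have h2 := one_sub_mul_I_ne_zero x
  have h3 : (1 - κ * x * Complex.I : ℂ) ≠ 0 := by
    simpa using one_sub_mul_I_ne_zero (κ * x)
  have h4 : (1 - (-((1 - κ) / (1 + κ)) * ((1 + x * Complex.I) / (1 - x * Complex.I))) : ℂ)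
      = 2 * (1 - κ * x * Complex.I) / ((1 + κ) * (1 - x * Complex.I)) := by
    field_simp
    ring
  have h5 : (1 + (-((1 - κ) / (1 + κ)) * ((1 + x * Complex.I) / (1 - x * Complex.I))) : ℂ)
      = 2 * (κ - x * Complex.I) / ((1 + κ) * (1 - x * Complex.I)) := by
    field_simp
    ring
  unfold discToHalfPlane halfPlaneCircle
  push_cast
  rw [h4, h5]
  have h6 : (x + κ * Complex.I : ℂ) = Complex.I * (κ - x * Complex.I) := by
    ring_nf
    simp
  rw [h6, div_div_div_eq,
    show (2 * (κ - x * Complex.I) * ((1 + κ) * (1 - x * Complex.I)) : ℂ)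
      = (κ - x * Complex.I) * (2 * ((1 + κ) * (1 - x * Complex.I))) by ring,
    show ((1 + κ) * (1 - x * Complex.I) * (2 * (1 - κ * x * Complex.I)) : ℂ)
      = (1 - κ * x * Complex.I) * (2 * ((1 + κ) * (1 - x * Complex.I))) by ring,
    mul_div_mul_right _ _ (mul_ne_zero two_ne_zero (mul_ne_zero h1 h2))]
  ring

lemma discToHalfPlane_im_pos {a η : ℝ} (hη : 0 < η) {ζ : ℂ} (hζ : ‖ζ‖ < 1) :
    0 < (discToHalfPlane a η ζ).im := by
  have h0 : (1 - ζ) ≠ 0 := by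
    intro h
    rw [sub_eq_zero] at h
    simp [← h] at hζ
  have h1 : (discToHalfPlane a η ζ).im = η * ((1 - ‖ζ‖ ^ 2) / Complex.normSq (1 - ζ)) := by
    have h2 : discToHalfPlane a η ζ = a + η * (Complex.I * ((1 + ζ) / (1 - ζ))) := by
      unfold discToHalfPlane
      ring
    rw [h2, Complex.add_im, Complex.ofReal_im, zero_add, Complex.im_ofReal_mul, Complex.I_mul_im,
      Complex.div_re, ← Complex.normSq_eq_norm_sq, Complex.normSq_apply ζ, ← add_div]
    congr 2
    simp
    ring
  rw [h1]
  have h2 : 0 < Complex.normSq (1 - ζ) := Complex.normSq_pos.2 h0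
  have h3 : 0 < 1 - ‖ζ‖ ^ 2 := by nlinarith [norm_nonneg ζ]
  positivity

lemma norm_one_add_div_one_sub (x : ℝ) :
    ‖(1 + x * Complex.I) / (1 - x * Complex.I)‖ = 1 := by
  rw [← exp_two_arctan_mul_I, Complex.norm_exp_ofReal_mul_I]

lemma halfPlaneCircle_im_pos {a η κ : ℝ} (hη : 0 < η) (hκ : 0 < κ) (hκ1 : κ ≤ 1) (x : ℝ) :
    0 < (halfPlaneCircle a η κ x).im := by
  rw [← discToHalfPlane_circle hκ.le]
  refine discToHalfPlane_im_pos hη ?_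
  rw [norm_mul, norm_one_add_div_one_sub, mul_one, norm_neg, Complex.norm_real, Real.norm_eq_abs,
    abs_of_nonneg (by apply div_nonneg <;> linarith), div_lt_one (by positivity)]
  linarith

lemma halfPlaneCircle_zero (a η x : ℝ) : halfPlaneCircle a η 0 x = (a + η * x : ℝ) := by
  simp [halfPlaneCircle]

lemma tendsto_halfPlaneCircle (a η x : ℝ) :
    Tendsto (fun κ => halfPlaneCircle a η κ x) (𝓝 0) (𝓝 ((a + η * x : ℝ) : ℂ)) := by
  rw [← halfPlaneCircle_zero]
  have : ContinuousAt (fun κ => halfPlaneCircle a η κ x) 0 := by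
    unfold halfPlaneCircle
    fun_prop (disch := simp)
  exact this

lemma norm_halfPlaneCircle_le {a η κ : ℝ} (hη : 0 < η) (hκ : 0 ≤ κ) (hκ1 : κ ≤ 1) (x : ℝ) :
    ‖halfPlaneCircle a η κ x‖ ≤ |a| + η * (|x| + 1) := by
  have h1 : 1 ≤ ‖(1 - κ * x * Complex.I : ℂ)‖ := by
    have := Complex.abs_re_le_norm (1 - κ * x * Complex.I : ℂ)
    simpa using this
  have h2 : ‖(x + κ * Complex.I : ℂ)‖ ≤ |x| + 1 := by
    refine (norm_add_le _ _).trans ?_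
    simp [abs_of_nonneg hκ, hκ1]
  unfold halfPlaneCircle
  refine (norm_add_le _ _).trans ?_
  rw [norm_mul, norm_div, Complex.norm_real, Complex.norm_real, Real.norm_eq_abs, Real.norm_eq_abs,
    abs_of_pos hη]
  gcongr
  exact (div_le_self (norm_nonneg _) h1).trans h2

lemma differentiableAt_discToHalfPlane (a η : ℝ) {ζ : ℂ} (hζ : ‖ζ‖ < 1) :
    DifferentiableAt ℂ (discToHalfPlane a η) ζ := by
  have h0 : (1 - ζ) ≠ 0 := by
    intro h
    rw [sub_eq_zero] at h
    simp [← h] at hζ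
  unfold discToHalfPlane
  fun_prop (disch := exact h0)

lemma exists_discToHalfPlane_eq (a : ℝ) {η : ℝ} (hη : 0 < η) {q : ℂ} (hq : 0 < q.im) :
    discToHalfPlane a η ((q - (a + η * Complex.I)) / (q - (a - η * Complex.I))) = q := by
  have h1 : q - (a - η * Complex.I) ≠ 0 := by
    intro h
    have := congrArg Complex.im h
    simp at this
    linarith
  have h2 : (η : ℂ) ≠ 0 := by simpa using hη.ne'
  unfold discToHalfPlane
  have h3 : 1 - (q - (a + η * Complex.I)) / (q - (a - η * Complex.I))
      = 2 * η * Complex.I / (q - (a - η * Complex.I)) := by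
    rw [eq_div_iff h1, sub_mul, div_mul_cancel₀ _ h1]
    ring
  have h4 : 1 + (q - (a + η * Complex.I)) / (q - (a - η * Complex.I))
      = 2 * (q - a) / (q - (a - η * Complex.I)) := by
    rw [eq_div_iff h1, add_mul, div_mul_cancel₀ _ h1]
    ring
  rw [h3, h4, div_div_div_cancel_right₀ h1]
  field_simp
  ring

/-! ### Jensen and Poisson formulas on the upper half-plane -/

/-- **Jensen's formula** on hyperbolic circles of the upper half-plane. -/
lemma exists_jensen_halfPlane {f : ℂ → ℂ} (hf : DifferentiableOn ℂ f {v | 0 < v.im})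
    (a : ℝ) {η κ : ℝ} (hη : 0 < η) (hκ : 0 < κ) (hκ1 : κ < 1)
    (hp : f (a + η * Complex.I) ≠ 0) :
    (Integrable fun x : ℝ => (1 + x ^ 2)⁻¹ * Real.log ‖f (halfPlaneCircle a η κ x)‖) ∧
    ∃ S : ℝ, 0 ≤ S ∧
      Real.pi⁻¹ * ∫ x : ℝ, (1 + x ^ 2)⁻¹ * Real.log ‖f (halfPlaneCircle a η κ x)‖
        = S + Real.log ‖f (a + η * Complex.I)‖ ∧
      ((∀ v : ℂ, 0 < v.im → f v ≠ 0) → S = 0) ∧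
      ∀ q : ℂ, 0 < q.im → f q = 0 →
        Real.log ((1 - κ) / (1 + κ) *
          ‖(q - (a + η * Complex.I)) / (q - (a - η * Complex.I))‖⁻¹) ≤ S := by
  set r : ℝ := (1 - κ) / (1 + κ) with hr
  have hr0 : 0 < r := div_pos (by linarith) (by linarith)
  have hr1 : r < 1 := by rw [hr, div_lt_one (by linarith)]; linarith
  set G : ℂ → ℂ := fun ζ => f (discToHalfPlane a η ζ) with hG
  have hGd : DifferentiableOn ℂ G (Metric.ball 0 1) := by
    intro ζ hζ
    have h1 : ‖ζ‖ < 1 := by simpa using hζ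
    have h2 : DifferentiableAt ℂ f (discToHalfPlane a η ζ) :=
      hf.differentiableAt ((isOpen_lt continuous_const Complex.continuous_im).mem_nhds
        (discToHalfPlane_im_pos hη h1))
    exact (h2.comp ζ (differentiableAt_discToHalfPlane a η h1)).differentiableWithinAt
  have hGa : AnalyticOnNhd ℂ G (Metric.closedBall 0 |r|) := by
    refine (hGd.analyticOnNhd Metric.isOpen_ball).mono fun ζ hζ => ?_
    rw [abs_of_pos hr0] at hζ
    simp only [mem_closedBall_zero_iff, mem_ball_zero_iff] at hζ ⊢
    linarith
  have hG0 : G 0 = f (a + η * Complex.I) := by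
    simp [hG, discToHalfPlane]
  have hpath : ∀ x : ℝ, G (-r * ((1 + x * Complex.I) / (1 - x * Complex.I)))
      = f (halfPlaneCircle a η κ x) := fun x => by
    rw [hG, hr]
    simp only
    rw [discToHalfPlane_circle hκ.le]
  have hint := (MeromorphicOn.circleIntegrable_log_norm (R := r)
    ((hGa.mono Metric.sphere_subset_closedBall).meromorphicOn)).integrable_arctan
  have hJ := hGa.circleAverage_log_norm hr0.ne' (by rwa [hG0])
  rw [circleAverage_eq_integral_arctan] at hJ
  simp only [hpath, hG0] at hint hJ
  -- `G` is holomorphic, so its divisor is nonnegative, and `log (r / |u|) ≥ 0` inside the disc; at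
  -- `u = 0` the logarithm takes the default value `0`.
  have hterm : ∀ u : ℂ, 0 ≤ ((MeromorphicOn.divisor G (Metric.closedBall 0 |r|) u : ℤ) : ℝ)
      * Real.log (r * ‖0 - u‖⁻¹) := by
    intro u
    by_cases hu : u ∈ Metric.closedBall 0 |r|
    · refine mul_nonneg (mod_cast MeromorphicOn.AnalyticOnNhd.divisor_nonneg hGa u) ?_
      rcases eq_or_ne u 0 with rfl | hu0
      · simp
      · refine Real.log_nonneg ?_
        rw [abs_of_pos hr0, mem_closedBall_zero_iff] at hu
        rw [zero_sub, norm_neg, ← div_eq_mul_inv, one_le_div (norm_pos_iff.2 hu0)]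
        exact hu
    · simp [Function.locallyFinsuppWithin.apply_eq_zero_of_notMem _ hu]
  refine ⟨hint, _, finsum_nonneg hterm, hJ, fun hne => ?_, fun q hq hfq => ?_⟩
  · refine finsum_eq_zero_of_forall_eq_zero fun u => ?_
    by_cases hu : u ∈ Metric.closedBall 0 |r|
    · have hu1 : ‖u‖ < 1 := by
        rw [abs_of_pos hr0, mem_closedBall_zero_iff] at hu
        linarith
      rw [MeromorphicOn.AnalyticOnNhd.divisor_apply hGa hu, (hGa u hu).analyticOrderAt_eq_zero.2
        (hne _ (discToHalfPlane_im_pos hη hu1))]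
      simp
    · simp [Function.locallyFinsuppWithin.apply_eq_zero_of_notMem _ hu]
  · set ζ := (q - (a + η * Complex.I)) / (q - (a - η * Complex.I)) with hζ
    have hGζ : G ζ = 0 := by
      rw [hG]
      simp only
      rw [hζ, exists_discToHalfPlane_eq a hη hq, hfq]
    have hζ0 : ζ ≠ 0 := fun h => hp (by rw [h] at hGζ; rw [← hG0, hGζ])
    by_cases hu : ζ ∈ Metric.closedBall 0 |r|
    · have hfin : Function.HasFiniteSupport fun u =>
          ((MeromorphicOn.divisor G (Metric.closedBall 0 |r|) u : ℤ) : ℝ)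
            * Real.log (r * ‖0 - u‖⁻¹) :=
        ((MeromorphicOn.divisor G (Metric.closedBall 0 |r|)).finiteSupport
          (isCompact_closedBall _ _)).subset fun u => by simp +contextual
      refine le_trans ?_ (single_le_finsum ζ hfin hterm)
      have hlog : 0 ≤ Real.log (r * ‖0 - ζ‖⁻¹) := by
        refine Real.log_nonneg ?_
        rw [abs_of_pos hr0, mem_closedBall_zero_iff] at hu
        rw [zero_sub, norm_neg, ← div_eq_mul_inv, one_le_div (norm_pos_iff.2 hζ0)]
        exact hu
      have hdiv : (1 : ℝ) ≤ ((MeromorphicOn.divisor G (Metric.closedBall 0 |r|) ζ : ℤ) : ℝ) := by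
        have h1 : (MeromorphicOn.divisor G (Metric.closedBall 0 |r|) ζ) ≠ 0 := by
          rw [MeromorphicOn.AnalyticOnNhd.divisor_apply hGa hu]
          have h2 : analyticOrderAt G ζ ≠ 0 := by
            rw [ne_eq, (hGa ζ hu).analyticOrderAt_eq_zero]
            simp [hGζ]
          -- Infinite order would force `G = 0` on the connected disc, against `G 0 ≠ 0`. So the
          -- zero counts at least once in the divisor.
          have h3 : analyticOrderAt G ζ ≠ ⊤ := by
            intro htop
            have h4 : EqOn G 0 (Metric.closedBall 0 |r|) :=
              hGa.eqOn_zero_of_preconnected_of_eventuallyEq_zero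
                (convex_closedBall _ _).isPreconnected hu (analyticOrderAt_eq_top.1 htop)
            exact hp (by rw [← hG0]; exact h4 (by simp))
          simp [h2, h3]
        have h5 := MeromorphicOn.AnalyticOnNhd.divisor_nonneg hGa ζ
        have h6 : (1 : ℤ) ≤ MeromorphicOn.divisor G (Metric.closedBall 0 |r|) ζ := by
          simp only [Function.locallyFinsuppWithin.coe_zero, Pi.zero_apply] at h5
          omega
        exact_mod_cast h6
      rw [zero_sub, norm_neg] at hlog ⊢
      nlinarith
    -- A zero outside the disc of radius `r` is not in the sum, but then the claimed lower bound is
    -- nonpositive.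
    · refine le_trans (Real.log_nonpos (by positivity) ?_) (finsum_nonneg hterm)
      rw [abs_of_pos hr0, mem_closedBall_zero_iff, not_le] at hu
      rw [← div_eq_mul_inv, div_le_one (by linarith)]
      exact hu.le

lemma tendsto_comp_halfPlaneCircle {f : ℂ → ℂ} (hf : ContinuousOn f {v | 0 ≤ v.im}) (a : ℝ) {η : ℝ}
    (hη : 0 < η) (x : ℝ) :
    Tendsto (fun n : ℕ => f (halfPlaneCircle a η (1 / ((n : ℝ) + 2)) x)) atTop
      (𝓝 (f (a + η * x : ℝ))) := by
  have h1 : Tendsto (fun n : ℕ => (1 / ((n : ℝ) + 2))) atTop (𝓝 0) := by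
    have := tendsto_one_div_add_atTop_nhds_zero_nat (𝕜 := ℝ)
    refine ((tendsto_add_atTop_iff_nat 1).2 this).congr fun n => ?_
    push_cast
    ring
  have h2 := (tendsto_halfPlaneCircle a η x).comp h1
  have h3 : ContinuousWithinAt f {v | 0 ≤ v.im} ((a + η * x : ℝ) : ℂ) := hf _ (by simp)
  refine h3.tendsto.comp (tendsto_nhdsWithin_iff.2 ⟨h2, Eventually.of_forall fun n => ?_⟩)
  refine (halfPlaneCircle_im_pos hη (by positivity) ?_ x).le
  rw [div_le_one (by positivity)]
  linarith [(Nat.cast_nonneg n : (0 : ℝ) ≤ n)]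

lemma measurable_comp_ofReal {f : ℂ → ℂ} (hf : ContinuousOn f {v | 0 ≤ v.im}) (a η : ℝ) :
    Measurable fun x : ℝ => f (a + η * x : ℝ) := by
  refine Continuous.measurable ?_
  refine hf.comp_continuous (by fun_prop) fun x => ?_
  simp

/-- The Poisson-Jensen inequality on the upper half-plane for a bounded function, with the
contribution of at most one zero. -/
lemma log_norm_add_le_poisson {B : ℂ → ℂ} (hB : DifferentiableOn ℂ B {v | 0 < v.im})
    (hBc : ContinuousOn B {v | 0 ≤ v.im}) (hb : ∀ v : ℂ, 0 < v.im → ‖B v‖ ≤ 1)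
    (a : ℝ) {η : ℝ} (hη : 0 < η) (hp : B (a + η * Complex.I) ≠ 0) {g : ℝ}
    (hg : g = 0 ∨ ∃ q : ℂ, 0 < q.im ∧ B q = 0 ∧
      g = Real.log ‖(q - (a + η * Complex.I)) / (q - (a - η * Complex.I))‖⁻¹) :
    (Integrable fun x : ℝ => (1 + x ^ 2)⁻¹ * Real.log ‖B (a + η * x : ℝ)‖) ∧
    Real.log ‖B (a + η * Complex.I)‖ + g
      ≤ Real.pi⁻¹ * ∫ x : ℝ, (1 + x ^ 2)⁻¹ * Real.log ‖B (a + η * x : ℝ)‖ := by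
  -- The offset `2` keeps `κ n < 1`, so that every circle has positive radius.
  set κ : ℕ → ℝ := fun n => 1 / ((n : ℝ) + 2) with hκ
  have hκ0 : ∀ n, 0 < κ n := fun n => by simp only [hκ]; positivity
  have hκ1 : ∀ n, κ n < 1 := fun n => by
    simp only [hκ]
    rw [div_lt_one (by positivity)]
    linarith [(Nat.cast_nonneg n : (0 : ℝ) ≤ n)]
  have hκt : Tendsto κ atTop (𝓝 0) := by
    have := tendsto_one_div_add_atTop_nhds_zero_nat (𝕜 := ℝ)
    refine ((tendsto_add_atTop_iff_nat 1).2 this).congr fun n => ?_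
    simp only [hκ]
    push_cast
    ring
  have hlim := fun x => tendsto_comp_halfPlaneCircle hBc a hη x
  have hneg : ∀ n x, 0 ≤ (1 + x ^ 2)⁻¹ * -Real.log ‖B (halfPlaneCircle a η (κ n) x)‖ := fun n x =>
    mul_nonneg (by positivity) (neg_nonneg.2 (Real.log_nonpos (norm_nonneg _)
      (hb _ (halfPlaneCircle_im_pos hη (hκ0 n) (hκ1 n).le x))))
  have hb0 : ∀ x : ℝ, ‖B (a + η * x : ℝ)‖ ≤ 1 := fun x =>
    le_of_tendsto (hlim x).norm (Eventually.of_forall fun n =>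
      hb _ (halfPlaneCircle_im_pos hη (hκ0 n) (hκ1 n).le x))
  have hneg0 : ∀ x : ℝ, 0 ≤ (1 + x ^ 2)⁻¹ * -Real.log ‖B (a + η * x : ℝ)‖ := fun x =>
    mul_nonneg (by positivity) (neg_nonneg.2 (Real.log_nonpos (norm_nonneg _) (hb0 x)))
  obtain ⟨gn, hgn, hgt⟩ : ∃ gn : ℕ → ℝ, (∀ n, ∫ x : ℝ, (1 + x ^ 2)⁻¹ *
      -Real.log ‖B (halfPlaneCircle a η (κ n) x)‖
        ≤ Real.pi * (-Real.log ‖B (a + η * Complex.I)‖ - gn n)) ∧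
      Tendsto gn atTop (𝓝 g) := by
    have key : ∀ n, ∃ S : ℝ, 0 ≤ S ∧ (∫ x : ℝ, (1 + x ^ 2)⁻¹ *
        -Real.log ‖B (halfPlaneCircle a η (κ n) x)‖
          = Real.pi * (-Real.log ‖B (a + η * Complex.I)‖ - S)) ∧
        ∀ q : ℂ, 0 < q.im → B q = 0 → Real.log ((1 - κ n) / (1 + κ n) *
          ‖(q - (a + η * Complex.I)) / (q - (a - η * Complex.I))‖⁻¹) ≤ S := by
      intro n
      obtain ⟨-, S, hS, h1, -, h3⟩ := exists_jensen_halfPlane hB a hη (hκ0 n) (hκ1 n) hp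
      refine ⟨S, hS, ?_, h3⟩
      simp only [mul_neg, integral_neg]
      rw [inv_mul_eq_iff_eq_mul₀ Real.pi_ne_zero] at h1
      rw [h1]
      ring
    choose S hS h1 h2 using key
    rcases hg with rfl | ⟨q, hq, hBq, rfl⟩
    · refine ⟨fun _ => 0, fun n => ?_, tendsto_const_nhds⟩
      rw [h1]
      exact mul_le_mul_of_nonneg_left (by linarith [hS n]) Real.pi_pos.le
    · refine ⟨fun n => Real.log ((1 - κ n) / (1 + κ n) *
          ‖(q - (a + η * Complex.I)) / (q - (a - η * Complex.I))‖⁻¹), fun n => ?_, ?_⟩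
      · rw [h1]
        exact mul_le_mul_of_nonneg_left (by linarith [h2 n q hq hBq]) Real.pi_pos.le
      · have hz : ‖(q - (a + η * Complex.I)) / (q - (a - η * Complex.I))‖⁻¹ ≠ 0 := by
          refine inv_ne_zero (norm_ne_zero_iff.2 ?_)
          refine div_ne_zero (fun h => hp ?_) fun h => ?_
          · rw [sub_eq_zero] at h
            rw [← h, hBq]
          · have := congrArg Complex.im h
            simp at this
            linarith
        have h3 : Tendsto (fun n => (1 - κ n) / (1 + κ n)) atTop (𝓝 ((1 - 0) / (1 + 0))) :=
          (hκt.const_sub 1).div (hκt.const_add 1) (by norm_num)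
        have h4 := (h3.mul_const ‖(q - (a + η * Complex.I)) / (q - (a - η * Complex.I))‖⁻¹).log
          (by simpa using hz)
        simpa using h4
  have hgt' : Tendsto (fun n => Real.pi * (-Real.log ‖B (a + η * Complex.I)‖ - gn n)) atTop
      (𝓝 (Real.pi * (-Real.log ‖B (a + η * Complex.I)‖ - g))) :=
    (hgt.const_sub _).const_mul _
  -- Fatou's lemma is applied to `-log ‖B‖ ≥ 0` in `ENNReal`; nonnegativity of the limiting bound
  -- allows the return to real numbers.
  have hfin : 0 ≤ Real.pi * (-Real.log ‖B (a + η * Complex.I)‖ - g) :=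
    ge_of_tendsto' hgt' fun n => (integral_nonneg (hneg n)).trans (hgn n)
  have hint : ∀ n, Integrable fun x : ℝ =>
      (1 + x ^ 2)⁻¹ * -Real.log ‖B (halfPlaneCircle a η (κ n) x)‖ := fun n => by
    simpa using (exists_jensen_halfPlane hB a hη (hκ0 n) (hκ1 n) hp).1.neg
  have hmeas : Measurable fun x : ℝ => (1 + x ^ 2)⁻¹ * -Real.log ‖B (a + η * x : ℝ)‖ := by
    have h1 : Measurable fun x : ℝ => (1 + x ^ 2)⁻¹ := by fun_prop
    exact h1.mul (measurable_comp_ofReal hBc a η).norm.log.neg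
  have hle : ∫⁻ x : ℝ, ENNReal.ofReal ((1 + x ^ 2)⁻¹ * -Real.log ‖B (a + η * x : ℝ)‖)
      ≤ ENNReal.ofReal (Real.pi * (-Real.log ‖B (a + η * Complex.I)‖ - g)) := by
    calc _ ≤ ∫⁻ x : ℝ, liminf (fun n => ENNReal.ofReal
            ((1 + x ^ 2)⁻¹ * -Real.log ‖B (halfPlaneCircle a η (κ n) x)‖)) atTop := by
          refine lintegral_mono fun x => ?_
          -- At a boundary zero the integrand has the default value `0` instead of `+∞`, and the
          -- bound by the lower limit is trivial.
          by_cases hx : B (a + η * x : ℝ) = 0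
          · rw [hx]
            simp
          · refine le_of_eq (Tendsto.liminf_eq ?_).symm
            exact ENNReal.tendsto_ofReal
              ((((hlim x).norm.log (norm_ne_zero_iff.2 hx)).neg).const_mul _)
      _ ≤ liminf (fun n => ∫⁻ x : ℝ, ENNReal.ofReal
            ((1 + x ^ 2)⁻¹ * -Real.log ‖B (halfPlaneCircle a η (κ n) x)‖)) atTop :=
          lintegral_liminf_le' fun n => (hint n).aestronglyMeasurable.aemeasurable.ennreal_ofReal
      _ ≤ liminf (fun n => ENNReal.ofReal
            (Real.pi * (-Real.log ‖B (a + η * Complex.I)‖ - gn n))) atTop := by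
          refine liminf_le_liminf (Eventually.of_forall fun n => ?_)
          rw [← ofReal_integral_eq_lintegral_ofReal (hint n) (Eventually.of_forall (hneg n))]
          exact ENNReal.ofReal_le_ofReal (hgn n)
      _ = _ := (ENNReal.tendsto_ofReal hgt').liminf_eq
  have hI : Integrable fun x : ℝ => (1 + x ^ 2)⁻¹ * -Real.log ‖B (a + η * x : ℝ)‖ := by
    refine ⟨hmeas.aestronglyMeasurable, ?_⟩
    rw [hasFiniteIntegral_iff_ofReal (Eventually.of_forall hneg0)]
    exact hle.trans_lt ENNReal.ofReal_lt_top
  rw [← ofReal_integral_eq_lintegral_ofReal hI (Eventually.of_forall hneg0),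
    ENNReal.ofReal_le_ofReal_iff hfin] at hle
  refine ⟨by simpa using hI.neg, ?_⟩
  simp only [mul_neg, integral_neg] at hle
  rw [← div_eq_inv_mul, le_div_iff₀ Real.pi_pos]
  linarith

/-- Growth of order `|x|^(1/2)` is integrable against the Poisson weight, the product being `O((1 +
|x|)^(-3/2))`. The exponent is `1/2` because `s` grows like `√v`. -/
lemma integrable_sqrt_bound (C D : ℝ) :
    Integrable fun x : ℝ => (1 + x ^ 2)⁻¹ * (C * (D * (1 + |x|)) ^ (1 / 2 : ℝ)) := by
  have h1 : Integrable fun x : ℝ => (1 + ‖x‖) ^ (-(3 / 2 : ℝ)) :=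
    integrable_one_add_norm (by simp; norm_num)
  have h2 : Measurable fun x : ℝ => (1 + x ^ 2)⁻¹ * (C * (D * (1 + |x|)) ^ (1 / 2 : ℝ)) := by
    fun_prop
  refine (h1.const_mul (2 * (|C| * |D| ^ (1 / 2 : ℝ)))).mono' h2.aestronglyMeasurable
    (Eventually.of_forall fun x => ?_)
  have h3 : 0 < 1 + |x| := by positivity
  have h4 : |(D * (1 + |x|)) ^ (1 / 2 : ℝ)| ≤ |D| ^ (1 / 2 : ℝ) * (1 + |x|) ^ (1 / 2 : ℝ) := by
    refine (Real.abs_rpow_le_abs_rpow _ _).trans ?_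
    rw [abs_mul, abs_of_pos h3, Real.mul_rpow (abs_nonneg _) h3.le]
  have h5 : (1 + x ^ 2)⁻¹ ≤ 2 * (1 + |x|) ^ (-2 : ℝ) := by
    rw [Real.rpow_neg h3.le, ← div_eq_mul_inv, inv_le_comm₀ (by positivity) (by positivity),
      inv_div, Real.rpow_two, div_le_iff₀ two_pos]
    nlinarith [sq_abs x, sq_nonneg (1 - |x|)]
  have h6 : (1 + |x|) ^ (-(3 / 2 : ℝ)) = (1 + |x|) ^ (-2 : ℝ) * (1 + |x|) ^ (1 / 2 : ℝ) := by
    rw [← Real.rpow_add h3]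
    norm_num
  rw [Real.norm_eq_abs, Real.norm_eq_abs, abs_mul, abs_mul, abs_of_pos (by positivity), h6]
  calc _ ≤ 2 * (1 + |x|) ^ (-2 : ℝ) * (|C| * (|D| ^ (1 / 2 : ℝ) * (1 + |x|) ^ (1 / 2 : ℝ))) := by
        gcongr
    _ = _ := by ring

/-- The Poisson formula on the upper half-plane for `log ‖f‖`, with `f` zero-free. -/
lemma log_norm_eq_poisson {f : ℂ → ℂ} (hf : DifferentiableOn ℂ f {v | 0 < v.im})
    (hfc : ContinuousOn f {v | 0 ≤ v.im}) (hne : ∀ v : ℂ, 0 ≤ v.im → f v ≠ 0) {C : ℝ}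
    (hC : ∀ v : ℂ, 0 ≤ v.im → |Real.log ‖f v‖| ≤ C * (1 + ‖v‖) ^ (1 / 2 : ℝ))
    (a : ℝ) {η : ℝ} (hη : 0 < η) :
    (Integrable fun x : ℝ => (1 + x ^ 2)⁻¹ * Real.log ‖f (a + η * x : ℝ)‖) ∧
    Real.log ‖f (a + η * Complex.I)‖
      = Real.pi⁻¹ * ∫ x : ℝ, (1 + x ^ 2)⁻¹ * Real.log ‖f (a + η * x : ℝ)‖ := by
  have hC0 : 0 ≤ C := by
    have := (abs_nonneg _).trans (hC 0 (by simp))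
    simpa using this
  have hκ0 : ∀ n : ℕ, 0 < 1 / ((n : ℝ) + 2) := fun n => by positivity
  have hκ1 : ∀ n : ℕ, 1 / ((n : ℝ) + 2) < 1 := fun n => by
    rw [div_lt_one (by positivity)]
    linarith [(Nat.cast_nonneg n : (0 : ℝ) ≤ n)]
  have hbd : ∀ (x : ℝ) (v : ℂ), 0 ≤ v.im → ‖v‖ ≤ |a| + η * (|x| + 1) →
      ‖(1 + x ^ 2)⁻¹ * Real.log ‖f v‖‖
        ≤ (1 + x ^ 2)⁻¹ * (C * ((1 + |a| + η) * (1 + |x|)) ^ (1 / 2 : ℝ)) := by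
    intro x v hv hvx
    rw [norm_mul, Real.norm_eq_abs, Real.norm_eq_abs, abs_of_pos (by positivity)]
    refine mul_le_mul_of_nonneg_left ((hC v hv).trans ?_) (by positivity)
    refine mul_le_mul_of_nonneg_left (Real.rpow_le_rpow (by positivity) ?_ (by norm_num)) hC0
    nlinarith [abs_nonneg a, abs_nonneg x, mul_nonneg (abs_nonneg a) (abs_nonneg x)]
  have hbound := integrable_sqrt_bound C (1 + |a| + η)
  have hmeas : Measurable fun x : ℝ => (1 + x ^ 2)⁻¹ * Real.log ‖f (a + η * x : ℝ)‖ := by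
    have h1 : Measurable fun x : ℝ => (1 + x ^ 2)⁻¹ := by fun_prop
    exact h1.mul (measurable_comp_ofReal hfc a η).norm.log
  refine ⟨hbound.mono' hmeas.aestronglyMeasurable (Eventually.of_forall fun x => ?_), ?_⟩
  · refine hbd x _ (by simp) ?_
    rw [Complex.norm_real, Real.norm_eq_abs]
    refine (abs_add_le _ _).trans ?_
    rw [abs_mul, abs_of_pos hη]
    linarith
  · have hJ : ∀ n : ℕ, Real.pi⁻¹ * ∫ x : ℝ, (1 + x ^ 2)⁻¹ *
        Real.log ‖f (halfPlaneCircle a η (1 / ((n : ℝ) + 2)) x)‖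
          = Real.log ‖f (a + η * Complex.I)‖ := by
      intro n
      obtain ⟨-, S, -, h1, h2, -⟩ := exists_jensen_halfPlane hf a hη (hκ0 n) (hκ1 n)
        (hne _ (by simpa using hη.le))
      rw [h1, h2 fun v hv => hne v hv.le, zero_add]
    -- Without zeros Jensen's formula has no extra term on any circle, and the growth bound is
    -- uniform in the radius, so dominated convergence applies.
    have hlim : Tendsto (fun n : ℕ => ∫ x : ℝ, (1 + x ^ 2)⁻¹ *
        Real.log ‖f (halfPlaneCircle a η (1 / ((n : ℝ) + 2)) x)‖) atTop
        (𝓝 (∫ x : ℝ, (1 + x ^ 2)⁻¹ * Real.log ‖f (a + η * x : ℝ)‖)) := by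
      refine tendsto_integral_of_dominated_convergence _ (fun n => ?_) hbound (fun n => ?_) ?_
      · exact (exists_jensen_halfPlane hf a hη (hκ0 n) (hκ1 n)
          (hne _ (by simpa using hη.le))).1.aestronglyMeasurable
      · exact Eventually.of_forall fun x => hbd x _
          (halfPlaneCircle_im_pos hη (hκ0 n) (hκ1 n).le x).le
          (norm_halfPlaneCircle_le hη (hκ0 n).le (hκ1 n).le x)
      · exact Eventually.of_forall fun x => ((tendsto_comp_halfPlaneCircle hfc a hη x).norm.log
          (norm_ne_zero_iff.2 (hne _ (by simp)))).const_mul _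
    have hlim2 := hlim.const_mul Real.pi⁻¹
    simp only [hJ] at hlim2
    exact tendsto_nhds_unique tendsto_const_nhds hlim2

/-! ### Integral representation and size of `(s - 1) ζ(s)` -/

/-- The fractional part of `t`, cut off to `t > 1`. -/
noncomputable def fractIoi (t : ℝ) : ℂ := (Ioi (1 : ℝ)).indicator (fun t => ((Int.fract t : ℝ) : ℂ)) t

lemma measurable_fractIoi : Measurable fractIoi :=
  (Complex.measurable_ofReal.comp measurable_fract).indicator measurableSet_Ioi

lemma norm_fractIoi_le (t : ℝ) : ‖fractIoi t‖ ≤ 1 := by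
  unfold fractIoi
  refine (norm_indicator_le_norm_self _ _).trans ?_
  rw [Complex.norm_real, Real.norm_eq_abs, abs_of_nonneg (Int.fract_nonneg t)]
  exact (Int.fract_lt_one t).le

lemma differentiableAt_mellin_fractIoi {s : ℂ} (hs : s.re < 0) :
    DifferentiableAt ℂ (mellin fractIoi) s := by
  -- Boundedness at infinity gives `a = 0`. The function vanishes near `0`, so any `b < s.re` would
  -- do.
  refine mellin_differentiableAt_of_isBigO_rpow (a := 0) (b := s.re - 1) ?_ ?_ hs ?_ (by linarith)
  · refine LocallyIntegrable.locallyIntegrableOn ?_ _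
    refine (locallyIntegrable_const (1 : ℝ)).mono measurable_fractIoi.aestronglyMeasurable
      (Eventually.of_forall fun t => ?_)
    simpa using norm_fractIoi_le t
  · refine Asymptotics.IsBigO.of_bound 1 (Eventually.of_forall fun t => ?_)
    simpa using norm_fractIoi_le t
  · refine Asymptotics.IsBigO.of_bound 1 ?_
    filter_upwards [nhdsWithin_le_nhds (Iio_mem_nhds (one_pos : (0 : ℝ) < 1))] with t ht
    have : fractIoi t = 0 := indicator_of_notMem (by simpa using (show t < 1 from ht).le) _
    rw [this, norm_zero]
    positivity

lemma mellin_fractIoi (s : ℂ) :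
    mellin fractIoi (-s) = ∫ t in Ioi (1 : ℝ), (t : ℂ) ^ (-s - 1) * ((Int.fract t : ℝ) : ℂ) := by
  unfold mellin fractIoi
  rw [← integral_indicator measurableSet_Ioi, ← integral_indicator measurableSet_Ioi]
  congr 1
  ext t
  by_cases ht : 1 < t
  · simp [indicator, ht, zero_lt_one.trans ht]
  · simp [indicator, ht]

lemma norm_mellin_fractIoi_le {s : ℂ} (hs : 0 < s.re) : ‖mellin fractIoi (-s)‖ ≤ 1 / s.re := by
  rw [mellin_fractIoi]
  have h1 : IntegrableOn (fun t : ℝ => t ^ (-s.re - 1)) (Ioi 1) :=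
    integrableOn_Ioi_rpow_of_lt (by linarith) one_pos
  have h2 : ∫ t in Ioi (1 : ℝ), t ^ (-s.re - 1) = 1 / s.re := by
    rw [integral_Ioi_rpow_of_lt (by linarith) one_pos]
    simp
  rw [← h2]
  refine norm_integral_le_of_norm_le h1 ?_
  filter_upwards [ae_restrict_mem measurableSet_Ioi] with t ht
  have ht0 : 0 < t := zero_lt_one.trans ht
  rw [norm_mul, Complex.norm_cpow_eq_rpow_re_of_pos ht0, Complex.norm_real, Real.norm_eq_abs,
    abs_of_nonneg (Int.fract_nonneg t)]
  simp only [Complex.sub_re, Complex.neg_re, Complex.one_re]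
  exact mul_le_of_le_one_right (by positivity) (Int.fract_lt_one t).le

/-- Partial summation gives `ζ(s) = s ∫₁^∞ ⌊t⌋ t^(-s-1) dt`; then `⌊t⌋ = t - {t}`, and the part with
`t` integrates to `1/(s - 1)`. -/
lemma riemannZeta₁_eq_of_one_lt_re {s : ℂ} (hs : 1 < s.re) :
    riemannZeta₁ s = s - s * (s - 1) * mellin fractIoi (-s) := by
  have hs1 : s ≠ 1 := by
    rintro rfl
    simp at hs
  have hs1' : s - 1 ≠ 0 := sub_ne_zero.2 hs1
  have h0 : riemannZeta s = s * ∫ t in Ioi (1 : ℝ), (⌊t⌋₊ : ℂ) * (t : ℂ) ^ (-(s + 1)) := by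
    rw [← LSeries_one_eq_riemannZeta hs,
      LSeries_eq_mul_integral 1 zero_le_one hs (LSeriesSummable_one_iff.2 hs)]
    · simp
    · refine Asymptotics.IsBigO.of_bound 1 (Eventually.of_forall fun n => ?_)
      simp
  have h1 : IntegrableOn (fun t : ℝ => (t : ℂ) ^ (-s)) (Ioi 1) :=
    integrableOn_Ioi_cpow_of_lt (by simpa using hs) one_pos
  have h2 : IntegrableOn (fun t : ℝ => (t : ℂ) ^ (-s - 1) * ((Int.fract t : ℝ) : ℂ)) (Ioi 1) := by
    have h3 : IntegrableOn (fun t : ℝ => (t : ℂ) ^ (-s - 1)) (Ioi 1) :=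
      integrableOn_Ioi_cpow_of_lt (by simp; linarith) one_pos
    refine Integrable.mul_bdd (c := 1) h3
      (Complex.measurable_ofReal.comp measurable_fract).aestronglyMeasurable
      (Eventually.of_forall fun t => ?_)
    rw [Complex.norm_real, Real.norm_eq_abs, abs_of_nonneg (Int.fract_nonneg t)]
    exact (Int.fract_lt_one t).le
  have h3 : ∫ t in Ioi (1 : ℝ), (⌊t⌋₊ : ℂ) * (t : ℂ) ^ (-(s + 1))
      = 1 / (s - 1) - mellin fractIoi (-s) := by
    have h4 : ∫ t in Ioi (1 : ℝ), (t : ℂ) ^ (-s) = 1 / (s - 1) := by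
      rw [integral_Ioi_cpow_of_lt (by simpa using hs) one_pos]
      simp only [Complex.ofReal_one, Complex.one_cpow]
      rw [neg_div, ← div_neg]
      congr 1
      ring
    rw [mellin_fractIoi, ← h4, ← integral_sub h1 h2]
    refine setIntegral_congr_fun measurableSet_Ioi fun t ht => ?_
    have ht0 : 0 < t := zero_lt_one.trans ht
    have ht1 : (t : ℂ) ≠ 0 := by simpa using ht0.ne'
    have h5 : ((Int.fract t : ℝ) : ℂ) = t - ⌊t⌋₊ := by
      rw [← Int.self_sub_floor, Complex.ofReal_sub, ← natCast_floor_eq_intCast_floor ht0.le]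
      simp
    have h6 : (t : ℂ) ^ (-s) = t * (t : ℂ) ^ (-s - 1) := by
      rw [Complex.cpow_sub _ _ ht1, Complex.cpow_one, mul_div_cancel₀ _ ht1]
    rw [h5, h6, show -(s + 1) = -s - 1 by ring]
    ring
  have h7 : riemannZeta₁ s = (s - 1) * riemannZeta s := by
    rw [riemannZeta_eq_inv_sub_mul hs1, mul_inv_cancel_left₀ hs1']
  rw [h7, h0, h3]
  field_simp

/-- Both sides are holomorphic on `Re s > 0` and agree on `Re s > 1`, so the identity theorem
applies. -/
lemma riemannZeta₁_eq {s : ℂ} (hs : 0 < s.re) :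
    riemannZeta₁ s = s - s * (s - 1) * mellin fractIoi (-s) := by
  have hopen : IsOpen {s : ℂ | 0 < s.re} := isOpen_lt continuous_const Complex.continuous_re
  have h1 : AnalyticOnNhd ℂ riemannZeta₁ {s : ℂ | 0 < s.re} :=
    differentiable_riemannZeta₁.differentiableOn.analyticOnNhd hopen
  have h2 : AnalyticOnNhd ℂ (fun s => s - s * (s - 1) * mellin fractIoi (-s))
      {s : ℂ | 0 < s.re} := by
    refine DifferentiableOn.analyticOnNhd (fun s hs => ?_) hopen
    have h3 : DifferentiableAt ℂ (fun s => mellin fractIoi (-s)) s :=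
      (differentiableAt_mellin_fractIoi (s := -s) (by simpa using hs)).comp s
        differentiableAt_id.neg
    exact (by fun_prop : DifferentiableAt ℂ
      (fun s => s - s * (s - 1) * mellin fractIoi (-s)) s).differentiableWithinAt
  refine h1.eqOn_of_preconnected_of_eventuallyEq h2
    (convex_halfSpace_re_gt 0).isPreconnected (z₀ := 2) (by simp) ?_ hs
  filter_upwards [(isOpen_lt continuous_const Complex.continuous_re).mem_nhds
    (show (1 : ℝ) < (2 : ℂ).re by simp)] with z hz
  exact riemannZeta₁_eq_of_one_lt_re hz

/-- The majorant uses `s + 1`, which dominates `s`, `s - 1` and `1` in modulus and never vanishes on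
this half-plane. -/
lemma norm_riemannZeta₁_le {s : ℂ} (hs : 1 / 2 ≤ s.re) :
    ‖riemannZeta₁ s‖ ≤ 3 * ‖s + 1‖ ^ 2 := by
  have h1 : ‖mellin fractIoi (-s)‖ ≤ 2 := by
    refine (norm_mellin_fractIoi_le (by linarith)).trans ?_
    rw [div_le_iff₀ (by linarith)]
    linarith
  have h2 : ‖s‖ ≤ ‖s + 1‖ := by
    rw [← sq_le_sq₀ (norm_nonneg _) (norm_nonneg _), ← Complex.normSq_eq_norm_sq,
      ← Complex.normSq_eq_norm_sq, Complex.normSq_apply, Complex.normSq_apply]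
    simp
    nlinarith
  have h3 : ‖s - 1‖ ≤ ‖s + 1‖ := by
    rw [← sq_le_sq₀ (norm_nonneg _) (norm_nonneg _), ← Complex.normSq_eq_norm_sq,
      ← Complex.normSq_eq_norm_sq, Complex.normSq_apply, Complex.normSq_apply]
    simp
    nlinarith
  have h4 : 1 ≤ ‖s + 1‖ := by
    have := Complex.abs_re_le_norm (s + 1)
    have h5 := le_abs_self (s + 1).re
    simp at this h5
    linarith
  rw [riemannZeta₁_eq (by linarith)]
  calc ‖s - s * (s - 1) * mellin fractIoi (-s)‖
      ≤ ‖s‖ + ‖s‖ * ‖s - 1‖ * ‖mellin fractIoi (-s)‖ := by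
        refine (norm_sub_le _ _).trans ?_
        rw [norm_mul, norm_mul]
    _ ≤ ‖s + 1‖ + ‖s + 1‖ * ‖s + 1‖ * 2 := by gcongr
    _ ≤ 3 * ‖s + 1‖ ^ 2 := by nlinarith

lemma riemannZeta₁_eq_mul {s : ℂ} (hs : s ≠ 1) : riemannZeta₁ s = (s - 1) * riemannZeta s := by
  rw [riemannZeta_eq_inv_sub_mul hs, mul_inv_cancel_left₀ (sub_ne_zero.2 hs)]

/-- On `(0, 1)` the representation reads `x + x (1 - x) ∫ {t} t^(-x-1) dt`, a positive number plus a
nonnegative one. -/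
lemma riemannZeta₁_ofReal_ne_zero {x : ℝ} (hx : 0 < x) : riemannZeta₁ x ≠ 0 := by
  rcases lt_or_ge x 1 with h1 | h1
  · have hreal : mellin fractIoi (-(x : ℂ))
        = ((∫ t in Ioi (1 : ℝ), t ^ (-x - 1) * Int.fract t : ℝ) : ℂ) := by
      rw [mellin_fractIoi, ← integral_complex_ofReal]
      refine setIntegral_congr_fun measurableSet_Ioi fun t ht => ?_
      have ht0 : 0 ≤ t := zero_le_one.trans (le_of_lt ht)
      rw [Complex.ofReal_mul, Complex.ofReal_cpow ht0]
      push_cast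
      rfl
    have hnn : 0 ≤ ∫ t in Ioi (1 : ℝ), t ^ (-x - 1) * Int.fract t := by
      refine setIntegral_nonneg measurableSet_Ioi fun t ht => ?_
      exact mul_nonneg (Real.rpow_nonneg (zero_le_one.trans (le_of_lt ht)) _) (Int.fract_nonneg t)
    rw [riemannZeta₁_eq (by simpa using hx), hreal]
    norm_cast
    have : 0 ≤ x * (1 - x) * ∫ t in Ioi (1 : ℝ), t ^ (-x - 1) * Int.fract t :=
      mul_nonneg (mul_nonneg hx.le (by linarith)) hnn
    nlinarith
  · rcases eq_or_lt_of_le h1 with rfl | h1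
    · simp
    · have h2 : (x : ℂ) ≠ 1 := by
        norm_cast
        exact h1.ne'
      rw [riemannZeta₁_eq_mul h2]
      exact mul_ne_zero (sub_ne_zero.2 h2)
        (riemannZeta_ne_zero_of_one_le_re (by simpa using h1.le))

/-- For `Re s ≥ 2`, `|ζ(s) - 1| ≤ π²/6 - 1 ≤ 7/10` and `|s - 1| ≥ 1`. -/
lemma le_norm_riemannZeta₁ {s : ℂ} (hs : 2 ≤ s.re) : 3 / 10 ≤ ‖riemannZeta₁ s‖ := by
  have hs1 : s ≠ 1 := by
    rintro rfl
    simp at hs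
  have hsum : Summable fun n : ℕ => 1 / ((n : ℂ) + 1) ^ s := by
    have := (Complex.summable_one_div_nat_cpow (p := s)).2 (by linarith)
    simpa using (summable_nat_add_iff 1).2 this
  have hterm : ∀ n : ℕ, ‖1 / (((n + 1 : ℕ) : ℂ) + 1) ^ s‖ ≤ 1 / ((n + 2 : ℕ) : ℝ) ^ 2 := by
    intro n
    have h0 : (((n + 1 : ℕ) : ℂ) + 1) = ((n + 2 : ℕ) : ℝ) := by
      push_cast
      ring
    rw [norm_div, norm_one, h0, Complex.norm_cpow_eq_rpow_re_of_pos (by positivity),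
      ← Real.rpow_two]
    refine one_div_le_one_div_of_le (by positivity) ?_
    refine Real.rpow_le_rpow_of_exponent_le ?_ hs
    push_cast
    linarith [(Nat.cast_nonneg n : (0 : ℝ) ≤ n)]
  have h2 : HasSum (fun n : ℕ => 1 / ((n + 2 : ℕ) : ℝ) ^ 2) (Real.pi ^ 2 / 6 - 1) := by
    have := (hasSum_nat_add_iff' 2).2 hasSum_zeta_two
    simpa [Finset.sum_range_succ] using this
  have h3 : ‖riemannZeta s - 1‖ ≤ Real.pi ^ 2 / 6 - 1 := by
    rw [zeta_eq_tsum_one_div_nat_add_one_cpow (by linarith), hsum.tsum_eq_zero_add]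
    simp only [Nat.cast_zero, zero_add, Complex.one_cpow, div_one, add_sub_cancel_left]
    exact tsum_of_norm_bounded h2 hterm
  have h4 : Real.pi ^ 2 / 6 - 1 ≤ 7 / 10 := by
    nlinarith [Real.pi_lt_d2, Real.pi_pos]
  have h5 : 3 / 10 ≤ ‖riemannZeta s‖ := by
    have := norm_sub_norm_le (1 : ℂ) (1 - riemannZeta s)
    rw [sub_sub_cancel, norm_one, norm_sub_rev] at this
    linarith
  have h6 : 1 ≤ ‖s - 1‖ := by
    have := Complex.abs_re_le_norm (s - 1)
    have h5 := le_abs_self (s - 1).re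
    simp at this h5
    linarith
  rw [riemannZeta₁_eq_mul hs1, norm_mul]
  nlinarith

/-! ### Zeros to the right of the critical line -/

lemma riemannZeta₁_ne_zero_of_riemannHypothesis (hRH : RiemannHypothesis) {s : ℂ}
    (hs : 1 / 2 < s.re) : riemannZeta₁ s ≠ 0 := by
  intro h
  rcases eq_or_ne s 1 with rfl | h1
  · simp at h
  · rw [riemannZeta₁_eq_mul h1, mul_eq_zero, sub_eq_zero] at h
    have := hRH s (h.resolve_left h1) ?_ h1
    · linarith
    · rintro ⟨n, rfl⟩
      simp at hs
      linarith [(Nat.cast_nonneg n : (0 : ℝ) ≤ n)]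

/-- In the functional equation at `2k + 2` the cosine equals `cos ((k + 1) π) = ±1`, and no other
factor vanishes. This rules out the odd poles of `Gamma` when zeros are reflected. -/
lemma riemannZeta_neg_odd_ne_zero (k : ℕ) : riemannZeta (-((2 * k + 1 : ℕ) : ℂ)) ≠ 0 := by
  have h1 : -((2 * k + 1 : ℕ) : ℂ) = 1 - ((2 * k + 2 : ℕ) : ℂ) := by
    push_cast
    ring
  have h2 : (1 : ℝ) < (((2 * k + 2 : ℕ) : ℂ)).re := by
    rw [Complex.natCast_re]
    exact_mod_cast (by omega : 1 < 2 * k + 2)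
  rw [h1, riemannZeta_one_sub]
  · have h3 : Complex.cos (Real.pi * ((2 * k + 2 : ℕ) : ℂ) / 2) ≠ 0 := by
      have : (Real.pi * ((2 * k + 2 : ℕ) : ℂ) / 2) = (((k + 1 : ℕ) * Real.pi : ℝ) : ℂ) := by
        push_cast
        ring
      rw [this, ← Complex.ofReal_cos, Real.cos_nat_mul_pi]
      norm_cast
      exact pow_ne_zero _ (by norm_num)
    refine mul_ne_zero (mul_ne_zero (mul_ne_zero (mul_ne_zero two_ne_zero ?_) ?_) h3) ?_
    · simp [Complex.cpow_eq_zero_iff, Real.pi_ne_zero]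
    · exact Complex.Gamma_ne_zero_of_re_pos (by linarith)
    · exact riemannZeta_ne_zero_of_one_lt_re h2
  · intro n h
    have := congrArg Complex.re h
    rw [Complex.neg_re, Complex.natCast_re n] at this
    linarith [(Nat.cast_nonneg n : (0 : ℝ) ≤ n)]
  · intro h
    rw [h] at h2
    simp at h2

/-- A nontrivial zero off the line is moved to `Re s > 1/2` by the functional equation and to `Im s
> 0` by conjugation; real zeros with `Re s > 1/2` do not exist. -/
lemma exists_zero_of_not_riemannHypothesis (hRH : ¬ RiemannHypothesis) :
    ∃ s : ℂ, 1 / 2 < s.re ∧ 0 < s.im ∧ riemannZeta₁ s = 0 := by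
  unfold RiemannHypothesis at hRH
  push Not at hRH
  obtain ⟨s, hs, htriv, hs1, hre⟩ := hRH
  have h1 : ∃ s : ℂ, 1 / 2 < s.re ∧ riemannZeta s = 0 := by
    rcases lt_or_gt_of_ne hre with h | h
    · refine ⟨1 - s, by simp; linarith, ?_⟩
      rw [riemannZeta_one_sub _ hs1, hs, mul_zero]
      rintro n rfl
      -- The functional equation needs `s ≠ -n`: `ζ(0) = -1/2`, the even `n > 0` are trivial zeros,
      -- and at odd `n` there is no zero.
      rcases Nat.even_or_odd' n with ⟨k, rfl | rfl⟩
      · rcases k with _ | k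
        · norm_num [riemannZeta_zero] at hs
        · exact htriv k (by push_cast; ring)
      · exact riemannZeta_neg_odd_ne_zero k hs
    · exact ⟨s, h, hs⟩
  obtain ⟨s, hre, hs⟩ := h1
  have hs1 : s ≠ 1 := by
    rintro rfl
    exact riemannZeta_one_ne_zero hs
  have hz : riemannZeta₁ s = 0 := by rw [riemannZeta₁_eq_mul hs1, hs, mul_zero]
  rcases lt_trichotomy s.im 0 with h | h | h
  · refine ⟨(starRingEnd ℂ) s, by simpa using hre, by simpa using h, ?_⟩
    rw [riemannZeta₁_eq_mul, riemannZeta_conj, hs, map_zero, mul_zero]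
    intro h2
    exact hs1 (by simpa using congrArg (starRingEnd ℂ) h2)
  · have : s = (s.re : ℂ) := Complex.ext rfl (by simpa using h)
    rw [this] at hz
    exact absurd hz (riemannZeta₁_ofReal_ne_zero (by linarith))
  · exact ⟨s, hre, h, hz⟩

/-! ### Two-sided bounds for `log |(s - 1) ζ(s)|` -/

/-- `H` is a primitive of `g' / g`, so `g e^(-H)` has zero derivative and is constant on the ball.
-/
lemma exists_log_of_ne_zero_on_ball {g : ℂ → ℂ} {R : ℝ} (hR : 0 < R)
    (hg : Differentiable ℂ g) (hne : ∀ z ∈ Metric.ball (0 : ℂ) R, g z ≠ 0) :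
    ∃ H : ℂ → ℂ, DifferentiableOn ℂ H (Metric.ball 0 R) ∧ H 0 = Complex.log (g 0) ∧
      ∀ z ∈ Metric.ball (0 : ℂ) R, Complex.exp (H z) = g z := by
  have hd : DifferentiableOn ℂ (fun z => deriv g z / g z) (Metric.ball 0 R) :=
    hg.contDiff.differentiable_deriv_two.differentiableOn.div hg.differentiableOn hne
  obtain ⟨H, hH0, hH⟩ := hd.isExactOn_ball.with_val_at 0 (Complex.log (g 0))
  have h0 : (0 : ℂ) ∈ Metric.ball (0 : ℂ) R := Metric.mem_ball_self hR
  refine ⟨H, fun z hz => (hH z hz).differentiableAt.differentiableWithinAt, hH0, fun z hz => ?_⟩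
  have hder : ∀ z ∈ Metric.ball (0 : ℂ) R,
      HasDerivAt (fun z => g z * Complex.exp (-H z)) 0 z := by
    intro z hz
    refine ((hg z).hasDerivAt.mul (hH z hz).neg.cexp).congr_deriv ?_
    field_simp [hne z hz]
    ring
  have hconst := (convex_ball (0 : ℂ) R).is_const_of_fderivWithin_eq_zero (𝕜 := ℂ)
    (f := fun z => g z * Complex.exp (-H z))
    (fun z hz => (hder z hz).differentiableAt.differentiableWithinAt)
    (fun z hz => by
      rw [fderivWithin_of_isOpen Metric.isOpen_ball hz]
      ext
      simp [(hder z hz).deriv]) hz h0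
  simp only [hH0, Complex.exp_neg, Complex.exp_log (hne 0 h0)] at hconst
  rw [mul_inv_cancel₀ (hne 0 h0), ← div_eq_mul_inv, div_eq_one_iff_eq (Complex.exp_ne_zero _)]
    at hconst
  exact hconst.symm

lemma log_norm_riemannZeta₁_le {s : ℂ} (hs : 1 / 2 ≤ s.re) :
    Real.log ‖riemannZeta₁ s‖ ≤ 4 * (1 + ‖s‖) := by
  rcases eq_or_ne (riemannZeta₁ s) 0 with h | h
  · rw [h, norm_zero, Real.log_zero]
    positivity
  · have h4 : 0 < ‖s + 1‖ := by
      rw [norm_pos_iff]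
      intro h0
      have := congrArg Complex.re h0
      simp at this
      linarith
    have h5 : ‖s + 1‖ ≤ ‖s‖ + 1 := by simpa using norm_add_le s 1
    refine (Real.log_le_log (norm_pos_iff.2 h) (norm_riemannZeta₁_le hs)).trans ?_
    rw [Real.log_mul (by norm_num) (by positivity), Real.log_pow]
    have h6 := Real.log_le_sub_one_of_pos (show (0 : ℝ) < 3 by norm_num)
    have h7 := Real.log_le_sub_one_of_pos h4
    push_cast
    linarith [norm_nonneg s]

lemma neg_log_norm_riemannZeta₁_le {s : ℂ} (hs : 2 ≤ s.re) :
    -Real.log ‖riemannZeta₁ s‖ ≤ 3 := by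
  have h1 := Real.log_le_log (by norm_num) (le_norm_riemannZeta₁ hs)
  have h2 : Real.log (10 / 3) = -Real.log (3 / 10) := by
    rw [← Real.log_inv]
    norm_num
  have h3 := Real.log_le_sub_one_of_pos (show (0 : ℝ) < 10 / 3 by norm_num)
  linarith

/-- The upper bound on `log |F|` is unconditional. Without zeros, `log F` exists on discs and
Borel-Carathéodory turns an upper bound for its real part into a bound for its modulus. -/
lemma exists_abs_log_norm_riemannZeta₁_le (hZ : ∀ s : ℂ, 1 / 2 < s.re → riemannZeta₁ s ≠ 0)
    {δ : ℝ} (hδ : 0 < δ) :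
    ∃ C : ℝ, ∀ s : ℂ, 1 / 2 + δ ≤ s.re → |Real.log ‖riemannZeta₁ s‖| ≤ C * (1 + ‖s‖) := by
  refine ⟨24 * (3 / δ) + 48 * (3 / δ) + 4, fun s hs => ?_⟩
  have hδ' : 0 < 3 / δ := by positivity
  rcases le_or_gt 2 s.re with h2 | h2
  · have h3 := neg_log_norm_riemannZeta₁_le h2
    have h4 := log_norm_riemannZeta₁_le (s := s) (by linarith)
    have h5 : 4 * (1 + ‖s‖) ≤ (24 * (3 / δ) + 48 * (3 / δ) + 4) * (1 + ‖s‖) := by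
      gcongr
      linarith
    rw [abs_le]
    constructor <;> linarith [norm_nonneg s]
  -- The disc of radius `3/2` about `2 + i Im s` just touches `Re = 1/2`, and `s` lies at distance
  -- at least `δ` from its boundary circle.
  · set c : ℂ := 2 + s.im * Complex.I with hc
    have hcre : c.re = 2 := by simp [hc]
    have hcs : ‖c‖ ≤ 2 + ‖s‖ := by
      refine (norm_add_le _ _).trans ?_
      rw [norm_mul, Complex.norm_I, mul_one, Complex.norm_real, Real.norm_eq_abs]
      simpa using Complex.abs_im_le_norm s
    have hre : ∀ z ∈ Metric.ball (0 : ℂ) (3 / 2), 1 / 2 < (c + z).re := fun z hz => by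
      have h1 := (Complex.abs_re_le_norm z)
      rw [mem_ball_zero_iff] at hz
      rw [Complex.add_re, hcre]
      linarith [neg_abs_le z.re]
    obtain ⟨H, hHd, hH0, hH⟩ := exists_log_of_ne_zero_on_ball (g := fun z => riemannZeta₁ (c + z))
      (R := 3 / 2) (by norm_num) (by fun_prop) fun z hz => hZ _ (hre z hz)
    have hHre : ∀ z ∈ Metric.ball (0 : ℂ) (3 / 2),
        (H z).re = Real.log ‖riemannZeta₁ (c + z)‖ := fun z hz => by
      rw [← hH z hz, Complex.norm_exp, Real.log_exp]
    set A : ℝ := 24 * (1 + ‖s‖) with hA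
    have hA0 : 0 < A := by positivity
    have hmaps : MapsTo H (Metric.ball 0 (3 / 2)) {z | z.re ≤ A} := fun z hz => by
      have h1 : ‖c + z‖ ≤ 2 + ‖s‖ + 3 / 2 := by
        refine (norm_add_le _ _).trans ?_
        rw [mem_ball_zero_iff] at hz
        linarith
      have h3 := log_norm_riemannZeta₁_le (s := c + z) (hre z hz).le
      simp only [mem_ofPred_eq, hHre z hz]
      linarith [norm_nonneg s]
    set z : ℂ := s - c with hz
    have hzr : z = ((s.re - 2 : ℝ) : ℂ) := by
      rw [hz, hc]
      apply Complex.ext <;> simp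
    have hznorm : ‖z‖ = 2 - s.re := by
      rw [hzr, Complex.norm_real, Real.norm_eq_abs, abs_of_neg (by linarith)]
      ring
    have hzb : z ∈ Metric.ball (0 : ℂ) (3 / 2) := by
      rw [mem_ball_zero_iff, hznorm]
      linarith
    have hBC := Complex.borelCaratheodory hA0 hHd hmaps (by norm_num) hzb
    have hH0n : ‖H 0‖ ≤ 16 * (1 + ‖s‖) := by
      rw [hH0]
      refine (Complex.norm_le_abs_re_add_abs_im _).trans ?_
      have h1 : |(Complex.log (riemannZeta₁ (c + 0))).im| ≤ Real.pi := by
        rw [Complex.log_im]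
        exact Complex.abs_arg_le_pi _
      have h3 : |(Complex.log (riemannZeta₁ (c + 0))).re| ≤ 12 * (1 + ‖s‖) := by
        rw [Complex.log_re, add_zero, abs_le]
        have h4 := log_norm_riemannZeta₁_le (s := c) (by rw [hcre]; norm_num)
        have h5 := neg_log_norm_riemannZeta₁_le (s := c) hcre.ge
        constructor <;> linarith [norm_nonneg s]
      linarith [Real.pi_lt_four, norm_nonneg s]
    have hfin : |Real.log ‖riemannZeta₁ s‖| ≤ ‖H z‖ := by
      have h1 := hHre z hzb
      rw [hz, add_sub_cancel] at h1
      rw [← h1, ← hz]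
      exact Complex.abs_re_le_norm _
    have hden : δ ≤ 3 / 2 - ‖z‖ := by
      rw [hznorm]
      linarith
    have hz3 : ‖z‖ ≤ 3 / 2 := by linarith
    calc _ ≤ 2 * A * ‖z‖ / (3 / 2 - ‖z‖) + ‖H 0‖ * (3 / 2 + ‖z‖) / (3 / 2 - ‖z‖) :=
          hfin.trans hBC
      _ ≤ 2 * A * (3 / 2) / δ + (16 * (1 + ‖s‖)) * (3 / 2 + 3 / 2) / δ := by gcongr
      _ ≤ (24 * (3 / δ) + 48 * (3 / δ) + 4) * (1 + ‖s‖) := by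
        have h1 : 2 * A * (3 / 2) / δ = 24 * (3 / δ) * (1 + ‖s‖) := by
          rw [hA]
          ring
        have h2 : (16 * (1 + ‖s‖)) * (3 / 2 + 3 / 2) / δ = 16 * (3 / δ) * (1 + ‖s‖) := by ring
        rw [h1, h2]
        have h3 : 0 ≤ 3 / δ * (1 + ‖s‖) := by positivity
        nlinarith [norm_nonneg s]

/-! ### The square root from the half-plane to the quadrant -/

/-- The branch of the square root mapping the closed upper half-plane to the closed first
quadrant. -/
noncomputable def upperSqrt (v : ℂ) : ℂ := Complex.sqrt Complex.I * Complex.sqrt (-Complex.I * v)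

lemma Complex.sqrt_pow_two (a : ℂ) : Complex.sqrt a ^ 2 = a := by
  simp [Complex.sqrt]

@[simp] lemma upperSqrt_pow_two (v : ℂ) : upperSqrt v ^ 2 = v := by
  -- The rotation by `-I` moves the branch cut to the negative imaginary axis, off the closed upper
  -- half-plane, and `√I` undoes it after the root is taken.
  rw [upperSqrt, mul_pow, Complex.sqrt_pow_two, Complex.sqrt_pow_two, ← mul_assoc, mul_neg,
    Complex.I_mul_I]
  ring

lemma upperSqrt_injective : Function.Injective upperSqrt := fun v w h => by
  rw [← upperSqrt_pow_two v, h, upperSqrt_pow_two]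

lemma upperSqrt_re_nonneg_im_nonneg {v : ℂ} (hv : 0 ≤ v.im) :
    0 ≤ (upperSqrt v).re ∧ 0 ≤ (upperSqrt v).im := by
  set w := Complex.sqrt (-Complex.I * v) with hw
  have h1 : 0 ≤ w.re := by
    rw [hw, Complex.sqrt, Complex.cpow_inv_two_re]
    positivity
  have h2 : w.im ^ 2 ≤ w.re ^ 2 := by
    have h3 := congrArg Complex.re (Complex.sqrt_pow_two (-Complex.I * v))
    rw [← hw] at h3
    simp [pow_two] at h3
    nlinarith
  have h4 : |w.im| ≤ w.re := by
    rw [← abs_of_nonneg h1]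
    exact sq_le_sq.1 h2
  have h5 := abs_le.1 h4
  have h6 : upperSqrt v = ((√2⁻¹ : ℝ) : ℂ) * ((1 + Complex.I) * w) := by
    rw [upperSqrt, Complex.sqrt_I, mul_assoc]
  rw [h6, Complex.re_ofReal_mul, Complex.im_ofReal_mul]
  constructor
  · refine mul_nonneg (Real.sqrt_nonneg _) ?_
    simp
    linarith
  · refine mul_nonneg (Real.sqrt_nonneg _) ?_
    simp
    linarith

lemma upperSqrt_re_pos_im_pos {v : ℂ} (hv : 0 < v.im) :
    0 < (upperSqrt v).re ∧ 0 < (upperSqrt v).im := by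
  obtain ⟨h1, h2⟩ := upperSqrt_re_nonneg_im_nonneg hv.le
  have h3 := congrArg Complex.im (upperSqrt_pow_two v)
  simp [pow_two] at h3
  constructor
  · refine lt_of_le_of_ne h1 fun h => ?_
    rw [← h] at h3
    linarith
  · refine lt_of_le_of_ne h2 fun h => ?_
    rw [← h] at h3
    linarith

lemma upperSqrt_of_sq_eq {v w : ℂ} (hv : 0 ≤ v.im) (hw : w ^ 2 = v) (hre : 0 ≤ w.re)
    (him : 0 ≤ w.im) : upperSqrt v = w := by
  obtain ⟨h1, h2⟩ := upperSqrt_re_nonneg_im_nonneg hv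
  rw [← upperSqrt_pow_two v] at hw
  rcases sq_eq_sq_iff_eq_or_eq_neg.1 hw with h | h
  · exact h.symm
  · have h3 := congrArg Complex.re h
    have h4 := congrArg Complex.im h
    simp at h3 h4
    refine Complex.ext ?_ ?_ <;> linarith

lemma upperSqrt_ofReal_of_nonneg {x : ℝ} (hx : 0 ≤ x) : upperSqrt x = (√x : ℝ) :=
  upperSqrt_of_sq_eq (by simp) (by rw [← Complex.ofReal_pow, Real.sq_sqrt hx]) (by simp) (by simp)

lemma upperSqrt_neg_sq {t : ℝ} (ht : 0 ≤ t) : upperSqrt (-t ^ 2 : ℝ) = t * Complex.I :=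
  upperSqrt_of_sq_eq (Complex.ofReal_im _).ge (by simp [mul_pow]) (by simp) (by simpa using ht)

lemma norm_upperSqrt (v : ℂ) : ‖upperSqrt v‖ = ‖v‖ ^ (1 / 2 : ℝ) := by
  rw [← Real.sqrt_eq_rpow, eq_comm, Real.sqrt_eq_iff_mul_self_eq (norm_nonneg _) (norm_nonneg _),
    ← pow_two, ← norm_pow, upperSqrt_pow_two]

lemma continuousAt_upperSqrt {v : ℂ} (hv : 0 ≤ v.im) : ContinuousAt upperSqrt v := by
  unfold upperSqrt
  have : ContinuousAt Complex.sqrt (-Complex.I * v) :=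
    Complex.continuousAt_sqrt (Or.inl (by simpa using hv))
  exact continuousAt_const.mul (this.comp (f := fun v => -Complex.I * v) (by fun_prop))

lemma differentiableAt_upperSqrt {v : ℂ} (hv : 0 < v.im ∨ 0 < v.re) :
    DifferentiableAt ℂ upperSqrt v := by
  unfold upperSqrt
  have : DifferentiableAt ℂ Complex.sqrt (-Complex.I * v) := by
    refine Complex.differentiableAt_sqrt (Complex.mem_slitPlane_iff.2 ?_)
    rcases hv with h | h
    · left
      simpa using h
    · right
      simpa using h.ne'
  exact (this.comp v (f := fun v => -Complex.I * v) (by fun_prop)).const_mul _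

/-! ### `(s - 1) ζ(s)` on the quadrant -/

/-- The function `(s - 1) ζ(s)` at `s = 1 / 2 + δ + √v`. -/
noncomputable def quadrantZeta (δ : ℝ) (v : ℂ) : ℂ := riemannZeta₁ (1 / 2 + δ + upperSqrt v)

/-- A zero-free function dominating `quadrantZeta δ` on the upper half-plane. -/
noncomputable def quadrantMajorant (δ : ℝ) (v : ℂ) : ℂ := 3 * (1 / 2 + δ + upperSqrt v + 1) ^ 2

lemma re_half_add_upperSqrt {δ : ℝ} {v : ℂ} (hv : 0 ≤ v.im) :
    1 / 2 + δ ≤ (1 / 2 + δ + upperSqrt v : ℂ).re := by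
  have := (upperSqrt_re_nonneg_im_nonneg hv).1
  simp
  linarith

lemma norm_quadrantZeta_le {δ : ℝ} (hδ : 0 ≤ δ) {v : ℂ} (hv : 0 ≤ v.im) :
    ‖quadrantZeta δ v‖ ≤ ‖quadrantMajorant δ v‖ := by
  have h1 := re_half_add_upperSqrt (δ := δ) hv
  refine (norm_riemannZeta₁_le (by linarith)).trans (le_of_eq ?_)
  rw [quadrantMajorant, norm_mul, norm_pow]
  norm_num

lemma one_le_norm_base {δ : ℝ} (hδ : 0 ≤ δ) {v : ℂ} (hv : 0 ≤ v.im) :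
    1 ≤ ‖(1 / 2 + δ + upperSqrt v + 1 : ℂ)‖ := by
  have h1 := re_half_add_upperSqrt (δ := δ) hv
  refine le_trans ?_ ((le_abs_self _).trans (Complex.abs_re_le_norm _))
  rw [Complex.add_re, Complex.one_re]
  linarith

lemma quadrantMajorant_ne_zero {δ : ℝ} (hδ : 0 ≤ δ) {v : ℂ} (hv : 0 ≤ v.im) :
    quadrantMajorant δ v ≠ 0 := by
  have h1 := one_le_norm_base hδ hv
  refine mul_ne_zero (by norm_num) (pow_ne_zero _ (norm_pos_iff.1 (by linarith)))

lemma differentiableOn_quadrantZeta (δ : ℝ) :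
    DifferentiableOn ℂ (quadrantZeta δ) {v | 0 < v.im} := fun v hv => by
  have h1 := differentiableAt_upperSqrt (Or.inl hv)
  have h2 : DifferentiableAt ℂ (fun v => (1 / 2 + δ + upperSqrt v : ℂ)) v := h1.const_add _
  exact (differentiable_riemannZeta₁.differentiableAt.comp v h2).differentiableWithinAt

lemma continuousOn_upperSqrt : ContinuousOn upperSqrt {v | 0 ≤ v.im} := fun _ hv =>
  (continuousAt_upperSqrt hv).continuousWithinAt

lemma continuousOn_quadrantZeta (δ : ℝ) : ContinuousOn (quadrantZeta δ) {v | 0 ≤ v.im} :=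
  differentiable_riemannZeta₁.continuous.comp_continuousOn
    (continuousOn_const.add continuousOn_upperSqrt)

lemma differentiableOn_quadrantMajorant (δ : ℝ) :
    DifferentiableOn ℂ (quadrantMajorant δ) {v | 0 < v.im} := fun v hv => by
  have h1 := differentiableAt_upperSqrt (Or.inl hv)
  unfold quadrantMajorant
  exact (by fun_prop : DifferentiableAt ℂ
    (fun v => (3 * (1 / 2 + δ + upperSqrt v + 1) ^ 2 : ℂ)) v).differentiableWithinAt

lemma continuousOn_quadrantMajorant (δ : ℝ) :
    ContinuousOn (quadrantMajorant δ) {v | 0 ≤ v.im} := by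
  have := continuousOn_upperSqrt
  unfold quadrantMajorant
  fun_prop

lemma rpow_half_le (v : ℂ) : ‖upperSqrt v‖ ≤ (1 + ‖v‖) ^ (1 / 2 : ℝ) := by
  rw [norm_upperSqrt]
  exact Real.rpow_le_rpow (norm_nonneg _) (by linarith) (by norm_num)

lemma one_le_rpow_half (v : ℂ) : 1 ≤ (1 + ‖v‖) ^ (1 / 2 : ℝ) :=
  Real.one_le_rpow (by linarith [norm_nonneg v]) (by norm_num)

lemma norm_half_add_le {δ : ℝ} (hδ : 0 ≤ δ) (v : ℂ) :
    ‖(1 / 2 + δ + upperSqrt v : ℂ)‖ ≤ (2 + δ) * (1 + ‖v‖) ^ (1 / 2 : ℝ) := by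
  have h2 : ‖(1 / 2 + δ + upperSqrt v : ℂ)‖ ≤ 1 / 2 + δ + ‖upperSqrt v‖ := by
    refine (norm_add_le _ _).trans (add_le_add ((norm_add_le _ _).trans ?_) le_rfl)
    rw [Complex.norm_real, Real.norm_eq_abs, abs_of_nonneg hδ]
    norm_num
  have h3 := rpow_half_le v
  have h4 := one_le_rpow_half v
  nlinarith

lemma abs_log_norm_quadrantMajorant_le {δ : ℝ} (hδ : 0 ≤ δ) {v : ℂ} (hv : 0 ≤ v.im) :
    |Real.log ‖quadrantMajorant δ v‖| ≤ (8 + 2 * δ) * (1 + ‖v‖) ^ (1 / 2 : ℝ) := by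
  have h1 := one_le_norm_base hδ hv
  have h2 : ‖(1 / 2 + δ + upperSqrt v + 1 : ℂ)‖ ≤ ‖(1 / 2 + δ + upperSqrt v : ℂ)‖ + 1 := by
    simpa using norm_add_le (1 / 2 + δ + upperSqrt v : ℂ) 1
  have h3 := norm_half_add_le hδ v
  have h4 := one_le_rpow_half v
  have h5 : ‖quadrantMajorant δ v‖ = 3 * ‖(1 / 2 + δ + upperSqrt v + 1 : ℂ)‖ ^ 2 := by
    rw [quadrantMajorant, norm_mul, norm_pow]
    norm_num
  have h6 := Real.log_le_sub_one_of_pos (show (0 : ℝ) < 3 by norm_num)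
  have h7 := Real.log_le_sub_one_of_pos
    (show 0 < ‖(1 / 2 + δ + upperSqrt v + 1 : ℂ)‖ by linarith)
  have h8 := Real.log_nonneg h1
  have h9 := Real.log_nonneg (show (1 : ℝ) ≤ 3 by norm_num)
  rw [h5, Real.log_mul (by norm_num) (by positivity), Real.log_pow]
  push_cast
  rw [abs_of_nonneg (by linarith)]
  nlinarith

lemma countable_zeros_riemannZeta₁ : {s | riemannZeta₁ s = 0}.Countable := by
  have h1 : {s | riemannZeta₁ s = 0} ⊆ ⋃ n : ℕ, Metric.closedBall (0 : ℂ) n ∩ riemannZetaZeros := by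
    intro s hs
    have hs1 : s ≠ 1 := by
      rintro rfl
      simp at hs
    rw [mem_ofPred_eq, riemannZeta₁_eq_mul hs1, mul_eq_zero, sub_eq_zero] at hs
    obtain ⟨n, hn⟩ := exists_nat_ge ‖s‖
    exact mem_iUnion.2 ⟨n, by simpa using hn, hs.resolve_left hs1⟩
  refine Countable.mono h1 (countable_iUnion fun n => ?_)
  exact ((isCompact_closedBall _ _).inter_riemannZetaZeros_finite).countable

/-- `log |F/E| = log |F| - log |E|` fails at zeros of `F` because of the value `log 0 = 0`. The
zeros are countable, hence negligible. -/
lemma ae_quadrantZeta_ne_zero (δ a : ℝ) {η : ℝ} (hη : η ≠ 0) :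
    ∀ᵐ x : ℝ, quadrantZeta δ (a + η * x : ℝ) ≠ 0 := by
  have hinj : Function.Injective fun x : ℝ => (1 / 2 + δ + upperSqrt (a + η * x : ℝ) : ℂ) := by
    intro x y h
    have h1 := upperSqrt_injective (add_left_cancel h)
    have h2 : η * x = η * y := add_left_cancel (Complex.ofReal_injective h1)
    exact mul_left_cancel₀ hη h2
  have := (countable_zeros_riemannZeta₁.preimage_of_injOn hinj.injOn).measure_zero volume
  rw [ae_iff]
  simpa [quadrantZeta] using this

/-- The Poisson-Jensen inequality for `log |(s - 1) ζ(s)|` on the quadrant. -/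
lemma log_norm_quadrantZeta_add_le {δ : ℝ} (hδ : 0 ≤ δ) (a : ℝ) {η : ℝ} (hη : 0 < η)
    (hp : quadrantZeta δ (a + η * Complex.I) ≠ 0) {g : ℝ}
    (hg : g = 0 ∨ ∃ q : ℂ, 0 < q.im ∧ quadrantZeta δ q = 0 ∧
      g = Real.log ‖(q - (a + η * Complex.I)) / (q - (a - η * Complex.I))‖⁻¹) :
    (Integrable fun x : ℝ => (1 + x ^ 2)⁻¹ * Real.log ‖quadrantZeta δ (a + η * x : ℝ)‖) ∧
    Real.log ‖quadrantZeta δ (a + η * Complex.I)‖ + g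
      ≤ Real.pi⁻¹ * ∫ x : ℝ, (1 + x ^ 2)⁻¹ * Real.log ‖quadrantZeta δ (a + η * x : ℝ)‖ := by
  obtain ⟨hE1, hE2⟩ := log_norm_eq_poisson (differentiableOn_quadrantMajorant δ)
    (continuousOn_quadrantMajorant δ) (fun v hv => quadrantMajorant_ne_zero hδ hv)
    (fun v hv => abs_log_norm_quadrantMajorant_le hδ hv) a hη
  have hpim : (0 : ℝ) ≤ (a + η * Complex.I : ℂ).im := by simpa using hη.le
  -- The quotient `F/E` is bounded by `1` and has the zeros of `F`. The exact Poisson formula for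
  -- `log |E|` is then added back.
  obtain ⟨hB1, hB2⟩ := log_norm_add_le_poisson
    (B := fun v => quadrantZeta δ v / quadrantMajorant δ v)
    ((differentiableOn_quadrantZeta δ).div (differentiableOn_quadrantMajorant δ)
      fun v hv => quadrantMajorant_ne_zero hδ (le_of_lt hv))
    ((continuousOn_quadrantZeta δ).div (continuousOn_quadrantMajorant δ)
      fun v hv => quadrantMajorant_ne_zero hδ hv)
    (fun v hv => by
      rw [norm_div]
      exact div_le_one_of_le₀ (norm_quadrantZeta_le hδ hv.le) (norm_nonneg _))
    a hη (div_ne_zero hp (quadrantMajorant_ne_zero hδ hpim)) (g := g)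
    (by
      rcases hg with h | ⟨q, h1, h2, h3⟩
      · exact Or.inl h
      · exact Or.inr ⟨q, h1, by simp [h2], h3⟩)
  have hsum : (fun x : ℝ => (1 + x ^ 2)⁻¹ * Real.log ‖quadrantZeta δ (a + η * x : ℝ)‖)
      =ᵐ[volume] fun x : ℝ => (1 + x ^ 2)⁻¹ *
        Real.log ‖quadrantZeta δ (a + η * x : ℝ) / quadrantMajorant δ (a + η * x : ℝ)‖
        + (1 + x ^ 2)⁻¹ * Real.log ‖quadrantMajorant δ (a + η * x : ℝ)‖ := by
    filter_upwards [ae_quadrantZeta_ne_zero δ a hη.ne'] with x hx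
    rw [norm_div, Real.log_div (norm_ne_zero_iff.2 hx)
      (norm_ne_zero_iff.2 (quadrantMajorant_ne_zero hδ (by simp)))]
    ring
  refine ⟨(hB1.add hE1).congr hsum.symm, ?_⟩
  rw [integral_congr_ae hsum, integral_add hB1 hE1, mul_add, ← hE2]
  rw [norm_div, Real.log_div (norm_ne_zero_iff.2 hp)
    (norm_ne_zero_iff.2 (quadrantMajorant_ne_zero hδ hpim))] at hB2
  linarith

lemma quadrantZeta_ofReal_ne_zero {δ x : ℝ} (hδ : 0 ≤ δ) (hx : 0 ≤ x) :
    quadrantZeta δ x ≠ 0 := by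
  rw [quadrantZeta, upperSqrt_ofReal_of_nonneg hx]
  have : (1 / 2 + δ + (√x : ℝ) : ℂ) = ((1 / 2 + δ + √x : ℝ) : ℂ) := by push_cast; ring
  rw [this]
  exact riemannZeta₁_ofReal_ne_zero (by positivity)

/-! ### Boundary zeros and the limit `δ → 0` on compact sets -/

lemma analyticAt_riemannZeta₁ (s : ℂ) : AnalyticAt ℂ riemannZeta₁ s :=
  differentiable_riemannZeta₁.analyticAt s

/-- The order of vanishing is finite because `riemannZeta₁ 1 = 1`. -/
lemma exists_riemannZeta₁_eq_pow_mul (s₀ : ℂ) :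
    ∃ (m : ℕ) (G : ℂ → ℂ), ContinuousAt G s₀ ∧ G s₀ ≠ 0 ∧
      ∀ᶠ s in 𝓝 s₀, riemannZeta₁ s = (s - s₀) ^ m * G s := by
  have hnt : ¬ ∀ᶠ s in 𝓝 s₀, riemannZeta₁ s = 0 := by
    intro h
    have h1 : AnalyticOnNhd ℂ riemannZeta₁ univ := fun s _ => analyticAt_riemannZeta₁ s
    have := h1.eqOn_zero_of_preconnected_of_eventuallyEq_zero isPreconnected_univ
      (mem_univ s₀) h (mem_univ 1)
    simp at this
  obtain ⟨m, G, hG, hG0, h⟩ := (analyticAt_riemannZeta₁ s₀).exists_eventuallyEq_pow_smul_nonzero_iff.2 hnt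
  exact ⟨m, G, hG.continuousAt, hG0, by simpa using h⟩

lemma continuous_upperSqrt_ofReal (a η : ℝ) : Continuous fun x : ℝ => upperSqrt (a + η * x : ℝ) :=
  continuousOn_upperSqrt.comp_continuous (by fun_prop) fun x => by simp

/-- Near a point of the boundary, `log ‖quadrantZeta δ‖` is dominated, uniformly in small `δ`, by a
function with at most a logarithmic singularity. -/
lemma exists_local_bound (a : ℝ) {η : ℝ} (hη : 0 < η) (x₀ : ℝ) :
    ∃ S ∈ 𝓝 x₀, ∃ ε > 0, ∃ b : ℝ → ℝ, (∀ x y, IntervalIntegrable b volume x y) ∧ (∀ x, 0 ≤ b x) ∧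
      ∀ᵐ x : ℝ, x ∈ S → ∀ δ ∈ Icc 0 ε,
        |Real.log ‖quadrantZeta δ (a + η * x : ℝ)‖| ≤ b x := by
  set w : ℝ → ℂ := fun x => upperSqrt (a + η * x : ℝ) with hw
  have hwc : Continuous w := continuous_upperSqrt_ofReal a η
  set s₀ : ℂ := 1 / 2 + w x₀ with hs₀
  obtain ⟨m, G, hGc, hG0, hG⟩ := exists_riemannZeta₁_eq_pow_mul s₀
  set σ : ℝ × ℝ → ℂ := fun z => 1 / 2 + z.1 + w z.2 with hσ
  have hσc : Continuous σ := by
    have : Continuous fun z : ℝ × ℝ => w z.2 := hwc.comp continuous_snd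
    fun_prop
  have hσ0 : σ (0, x₀) = s₀ := by simp [hσ, hs₀]
  have hσt : Tendsto σ (𝓝 (0, x₀)) (𝓝 s₀) := hσ0 ▸ hσc.continuousAt.tendsto
  set M : ℝ := |Real.log ‖G s₀‖| + 1 with hM
  have hev1 : ∀ᶠ s in 𝓝 s₀, |Real.log ‖G s‖| < M ∧ G s ≠ 0 := by
    refine Eventually.and ?_ (hGc.eventually_ne hG0)
    exact (hGc.norm.log (norm_ne_zero_iff.2 hG0)).abs.eventually_lt_const (by simp [hM])
  have hev2 : ∀ᶠ s in 𝓝 s₀, ‖s - s₀‖ < 1 := by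
    filter_upwards [Metric.ball_mem_nhds s₀ one_pos] with s hs
    rwa [mem_ball_iff_norm] at hs
  have hev3 : ∀ᶠ z : ℝ × ℝ in 𝓝 (0, x₀), ‖w z.2 + w x₀‖ < 2 * ‖w x₀‖ + 1 := by
    have : ContinuousAt (fun z : ℝ × ℝ => ‖w z.2 + w x₀‖) (0, x₀) :=
      ((hwc.comp continuous_snd).add continuous_const).norm.continuousAt
    refine this.eventually_lt_const ?_
    simp only
    rw [← two_mul, norm_mul, Complex.norm_ofNat]
    linarith
  -- A boundary zero can only lie on the critical line, that is at `a + η x₀ < 0`, since `F` does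
  -- not vanish on the real ray, corner `s = 1/2` included.
  have hev4 : ∀ᶠ z : ℝ × ℝ in 𝓝 (0, x₀), m = 0 ∨ a + η * z.2 < 0 := by
    rcases Nat.eq_zero_or_pos m with h | h
    · exact Eventually.of_forall fun _ => Or.inl h
    · have hz : quadrantZeta 0 (a + η * x₀ : ℝ) = 0 := by
        have h1 : riemannZeta₁ s₀ = (s₀ - s₀) ^ m * G s₀ := hG.self_of_nhds
        rw [sub_self, zero_pow h.ne', zero_mul] at h1
        rw [quadrantZeta]
        simpa [hs₀, hw] using h1
      have hneg : a + η * x₀ < 0 := by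
        by_contra hcon
        exact quadrantZeta_ofReal_ne_zero le_rfl (not_lt.1 hcon) hz
      have hc : ContinuousAt (fun z : ℝ × ℝ => a + η * z.2) (0, x₀) := by fun_prop
      exact (hc.eventually_lt_const hneg).mono fun _ => Or.inr
  obtain ⟨T, hT, S, hS, hTS⟩ := mem_nhds_prod_iff.1
    (((hσt.eventually (hG.and (hev1.and hev2))).and (hev3.and hev4)))
  obtain ⟨ε, hε, hεT⟩ := Metric.mem_nhds_iff.1 hT
  set c : ℝ := η / (2 * ‖w x₀‖ + 1) with hc
  have hc0 : 0 < c := by positivity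
  refine ⟨S, hS, ε / 2, by positivity,
    fun x => M + m * (|Real.log c| + |Real.log (x - x₀)|), fun x y => ?_, fun x => ?_, ?_⟩
  · have h1 : IntervalIntegrable (fun x => Real.log (x - x₀)) volume x y := by
      simpa using (intervalIntegral.intervalIntegrable_log' (a := x - x₀) (b := y - x₀)).comp_sub_right x₀
    exact intervalIntegrable_const.add ((intervalIntegrable_const.add h1.abs).const_mul _)
  · positivity
  · have hae : ∀ᵐ x : ℝ, x ≠ x₀ := by simp [ae_iff]
    filter_upwards [hae] with x hx hxS δ hδ
    have hmem : (δ, x) ∈ T ×ˢ S := by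
      refine ⟨hεT ?_, hxS⟩
      rw [mem_ball_zero_iff, Real.norm_eq_abs, abs_of_nonneg hδ.1]
      linarith [hδ.2]
    obtain ⟨⟨h1, ⟨h2, h2'⟩, h3⟩, h4, h5⟩ := hTS hmem
    simp only at h4 h5
    have hz : quadrantZeta δ (a + η * x : ℝ) = riemannZeta₁ (σ (δ, x)) := rfl
    rw [hz, h1]
    rcases h5 with rfl | h5
    · simpa using h2.le
    · have h0 : a + η * x₀ < 0 ∨ m = 0 := by
        have := hTS (⟨mem_of_mem_nhds hT, mem_of_mem_nhds hS⟩ : ((0 : ℝ), x₀) ∈ T ×ˢ S)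
        exact this.2.2.symm
      rcases h0 with h0 | rfl
      swap
      · simpa using h2.le
      have him : ∀ y : ℝ, a + η * y < 0 → w y = (√(-(a + η * y)) : ℝ) * Complex.I := by
        intro y hy
        have := upperSqrt_neg_sq (Real.sqrt_nonneg (-(a + η * y)))
        rw [Real.sq_sqrt (by linarith), neg_neg] at this
        exact this
      have hdiff : σ (δ, x) - s₀ = δ + (w x - w x₀) := by
        simp only [hσ, hs₀]
        ring
      -- On the critical line `w x - w x₀` is purely imaginary while `δ` is real, so the shift by
      -- `δ` only increases the distance to the zero. This makes the bound uniform in `δ`.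
      have hlow : c * |x - x₀| ≤ ‖σ (δ, x) - s₀‖ := by
        have h6 : ‖w x - w x₀‖ ≤ ‖σ (δ, x) - s₀‖ := by
          rw [hdiff, him x h5, him x₀ h0, ← sub_mul, ← Complex.ofReal_sub, norm_mul, Complex.norm_I,
            mul_one, Complex.norm_real, Real.norm_eq_abs]
          refine le_trans (le_of_eq ?_) (Complex.abs_im_le_norm _)
          simp
        have h7 : η * |x - x₀| = ‖w x - w x₀‖ * ‖w x + w x₀‖ := by
          rw [← norm_mul, show (w x - w x₀) * (w x + w x₀) = w x ^ 2 - w x₀ ^ 2 by ring]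
          simp only [hw, upperSqrt_pow_two]
          rw [← Complex.ofReal_sub, Complex.norm_real, Real.norm_eq_abs,
            show a + η * x - (a + η * x₀) = η * (x - x₀) by ring, abs_mul, abs_of_pos hη]
        rw [hc, div_mul_eq_mul_div, div_le_iff₀ (by positivity), h7]
        gcongr
      have hx0 : 0 < |x - x₀| := abs_pos.2 (sub_ne_zero.2 hx)
      have hpos : 0 < ‖σ (δ, x) - s₀‖ := lt_of_lt_of_le (by positivity) hlow
      have hlog := Real.log_le_log (by positivity) hlow
      rw [Real.log_mul hc0.ne' hx0.ne', Real.log_abs] at hlog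
      have hlog0 := Real.log_nonpos (norm_nonneg _) h3.le
      rw [norm_mul, norm_pow, Real.log_mul (by positivity) (norm_ne_zero_iff.2 h2'), Real.log_pow]
      have hkey : |Real.log ‖σ (δ, x) - s₀‖| ≤ |Real.log c| + |Real.log (x - x₀)| := by
        rw [abs_of_nonpos hlog0]
        linarith [neg_abs_le (Real.log c), neg_abs_le (Real.log (x - x₀))]
      calc |m * Real.log ‖σ (δ, x) - s₀‖ + Real.log ‖G (σ (δ, x))‖|
          ≤ m * |Real.log ‖σ (δ, x) - s₀‖| + |Real.log ‖G (σ (δ, x))‖| := by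
            refine (abs_add_le _ _).trans ?_
            rw [abs_mul, Nat.abs_cast]
        _ ≤ _ := by
            have := mul_le_mul_of_nonneg_left hkey (Nat.cast_nonneg m : (0 : ℝ) ≤ m)
            linarith

lemma exists_compact_bound (a : ℝ) {η : ℝ} (hη : 0 < η) {K : Set ℝ} (hK : IsCompact K) :
    ∃ ε > 0, ∃ b : ℝ → ℝ, (∀ x y, IntervalIntegrable b volume x y) ∧ (∀ x, 0 ≤ b x) ∧
      ∀ᵐ x : ℝ, x ∈ K → ∀ δ ∈ Icc 0 ε,
        |Real.log ‖quadrantZeta δ (a + η * x : ℝ)‖| ≤ b x := by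
  refine hK.induction_on (p := fun K => ∃ ε > 0, ∃ b : ℝ → ℝ,
    (∀ x y, IntervalIntegrable b volume x y) ∧ (∀ x, 0 ≤ b x) ∧ ∀ᵐ x : ℝ, x ∈ K → ∀ δ ∈ Icc 0 ε,
      |Real.log ‖quadrantZeta δ (a + η * x : ℝ)‖| ≤ b x) ?_ ?_ ?_ ?_
  · exact ⟨1, one_pos, fun _ => 0, fun _ _ => intervalIntegrable_const, fun _ => le_rfl, by simp⟩
  · rintro s t hst ⟨ε, hε, b, h1, h2, h3⟩
    exact ⟨ε, hε, b, h1, h2, h3.mono fun x hx hxs => hx (hst hxs)⟩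
  · rintro s t ⟨ε, hε, b, h1, h2, h3⟩ ⟨ε', hε', b', h1', h2', h3'⟩
    refine ⟨min ε ε', lt_min hε hε', fun x => b x + b' x, fun x y => (h1 x y).add (h1' x y),
      fun x => add_nonneg (h2 x) (h2' x), ?_⟩
    filter_upwards [h3, h3'] with x hx hx' hxst δ hδ
    rcases hxst with h | h
    · linarith [hx h δ ⟨hδ.1, hδ.2.trans (min_le_left _ _)⟩, h2' x]
    · linarith [hx' h δ ⟨hδ.1, hδ.2.trans (min_le_right _ _)⟩, h2 x]
  · intro x _
    obtain ⟨S, hS, h⟩ := exists_local_bound a hη x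
    exact ⟨S, mem_nhdsWithin_of_mem_nhds hS, h⟩

lemma tendsto_integral_Icc_quadrantZeta (a : ℝ) {η : ℝ} (hη : 0 < η) {N : ℝ} (hN : 0 ≤ N) :
    Tendsto (fun n : ℕ => ∫ x in Icc (-N) N, (1 + x ^ 2)⁻¹ *
        Real.log ‖quadrantZeta (1 / ((n : ℝ) + 1)) (a + η * x : ℝ)‖) atTop
      (𝓝 (∫ x in Icc (-N) N, (1 + x ^ 2)⁻¹ * Real.log ‖quadrantZeta 0 (a + η * x : ℝ)‖)) := by
  obtain ⟨ε, hε, b, hb, hb0, hbound⟩ := exists_compact_bound a hη (isCompact_Icc (a := -N) (b := N))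
  have hδ := tendsto_one_div_add_atTop_nhds_zero_nat (𝕜 := ℝ)
  refine tendsto_integral_filter_of_dominated_convergence b ?_ ?_ ?_ ?_
  · refine Eventually.of_forall fun n => ?_
    have h1 : Measurable fun x : ℝ => (1 + x ^ 2)⁻¹ := by fun_prop
    exact (h1.mul (measurable_comp_ofReal (continuousOn_quadrantZeta _) a η).norm.log).aestronglyMeasurable
  · filter_upwards [hδ.eventually_lt_const hε] with n hn
    filter_upwards [ae_restrict_of_ae hbound, ae_restrict_mem measurableSet_Icc] with x hx hxK
    have h1 := hx hxK (1 / ((n : ℝ) + 1)) ⟨by positivity, hn.le⟩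
    rw [norm_mul, Real.norm_eq_abs, Real.norm_eq_abs, abs_of_pos (by positivity)]
    refine (mul_le_of_le_one_left (abs_nonneg _) ?_).trans h1
    exact inv_le_one_of_one_le₀ (by nlinarith [sq_nonneg x])
  · change IntegrableOn b (Icc (-N) N)
    rw [integrableOn_Icc_iff_integrableOn_Ioc,
      ← intervalIntegrable_iff_integrableOn_Ioc_of_le (by linarith)]
    exact hb _ _
  · filter_upwards [ae_restrict_of_ae (ae_quadrantZeta_ne_zero 0 a hη.ne')] with x hx
    have h1 : Tendsto (fun n : ℕ => quadrantZeta (1 / ((n : ℝ) + 1)) (a + η * x : ℝ)) atTop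
        (𝓝 (quadrantZeta 0 (a + η * x : ℝ))) := by
      unfold quadrantZeta
      refine (differentiable_riemannZeta₁.continuous.tendsto _).comp ?_
      refine Tendsto.add_const _ (Tendsto.const_add _ ?_)
      exact (Complex.continuous_ofReal.tendsto _).comp hδ
    exact (h1.norm.log (norm_ne_zero_iff.2 hx)).const_mul _

/-! ### The Poisson formula when there are no zeros -/

/-- The Poisson formula on a shifted quadrant, away from possible boundary zeros. -/
lemma log_norm_quadrantZeta_eq_poisson (hZ : ∀ s : ℂ, 1 / 2 < s.re → riemannZeta₁ s ≠ 0)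
    {δ : ℝ} (hδ : 0 < δ) (a : ℝ) {η : ℝ} (hη : 0 < η) :
    (Integrable fun x : ℝ => (1 + x ^ 2)⁻¹ * Real.log ‖quadrantZeta δ (a + η * x : ℝ)‖) ∧
    Real.log ‖quadrantZeta δ (a + η * Complex.I)‖
      = Real.pi⁻¹ * ∫ x : ℝ, (1 + x ^ 2)⁻¹ * Real.log ‖quadrantZeta δ (a + η * x : ℝ)‖ := by
  obtain ⟨C, hC⟩ := exists_abs_log_norm_riemannZeta₁_le hZ hδ
  refine log_norm_eq_poisson (differentiableOn_quadrantZeta δ) (continuousOn_quadrantZeta δ)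
    (fun v hv => hZ _ ?_) (C := |C| * (3 + δ)) (fun v hv => ?_) a hη
  · linarith [re_half_add_upperSqrt (δ := δ) hv]
  · refine (hC _ (re_half_add_upperSqrt hv)).trans ?_
    have h1 := norm_half_add_le hδ.le v
    have h2 := one_le_rpow_half v
    calc C * (1 + ‖(1 / 2 + δ + upperSqrt v : ℂ)‖)
        ≤ |C| * (1 + ‖(1 / 2 + δ + upperSqrt v : ℂ)‖) := by
          gcongr
          exact le_abs_self C
      _ ≤ |C| * ((3 + δ) * (1 + ‖v‖) ^ (1 / 2 : ℝ)) := by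
          gcongr
          linarith
      _ = _ := by ring

/-- The part of a Poisson integral of a nonnegative function over `|x| > N` is controlled by the
Poisson integral at a higher point. -/
lemma setIntegral_compl_Icc_le {V : ℝ → ℝ} (hV : ∀ v, 0 ≤ V v) (a η : ℝ) {N : ℝ} (hN : 1 ≤ N)
    (h1 : Integrable fun x : ℝ => (1 + x ^ 2)⁻¹ * V (a + η * x))
    (h2 : Integrable fun x : ℝ => (1 + x ^ 2)⁻¹ * V (a + η * N * x)) :
    ∫ x in (Icc (-N) N)ᶜ, (1 + x ^ 2)⁻¹ * V (a + η * x)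
      ≤ 2 / N * ∫ x : ℝ, (1 + x ^ 2)⁻¹ * V (a + η * N * x) := by
  have hN0 : 0 < N := by linarith
  have h3 := Measure.integral_comp_div (fun x : ℝ => (1 + x ^ 2)⁻¹ * V (a + η * N * x)) N
  have h4 : Integrable fun x : ℝ => (1 + (x / N) ^ 2)⁻¹ * V (a + η * N * (x / N)) :=
    h2.comp_div hN0.ne'
  rw [abs_of_pos hN0, smul_eq_mul] at h3
  have h5 : ∀ x : ℝ, η * N * (x / N) = η * x := fun x => by field_simp
  simp only [h5] at h3 h4
  have h6 : 2 / N = 2 / N ^ 2 * N := by field_simp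
  rw [h6, mul_assoc, ← h3,
    ← integral_const_mul]
  -- For `|x| ≥ N` one has `N² + x² ≤ 2 (1 + x²)`, which compares the Poisson weights at heights `η`
  -- and `η N`.
  calc _ ≤ ∫ x in (Icc (-N) N)ᶜ, 2 / N ^ 2 * ((1 + (x / N) ^ 2)⁻¹ * V (a + η * x)) := by
        refine setIntegral_mono_on h1.integrableOn (h4.const_mul _).integrableOn
          measurableSet_Icc.compl fun x hx => ?_
        rw [← mul_assoc]
        refine mul_le_mul_of_nonneg_right ?_ (hV _)
        have hx2 : N ^ 2 ≤ x ^ 2 := by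
          rw [← sq_abs x]
          refine pow_le_pow_left₀ hN0.le ?_ 2
          by_contra hcon
          exact hx (abs_le.1 (not_le.1 hcon).le)
        rw [div_pow, ← div_eq_mul_inv, div_div, inv_eq_one_div,
          div_le_div_iff₀ (by positivity) (by positivity)]
        rw [mul_add, mul_div_cancel₀ _ (by positivity)]
        nlinarith
    _ ≤ _ := by
        refine setIntegral_le_integral (h4.const_mul _) (Eventually.of_forall fun x => ?_)
        have := hV (a + η * x)
        positivity

/-- With `a ≥ 0` and `η N ≥ 5`, the square root has real part at least `3/2`, so `Re s ≥ 2`, where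
`|F|` is bounded below. Only the growth of the majorant, of order `N^(1/2)`, remains. -/
lemma quadrant_excess_le {δ a η N : ℝ} (hδ : 0 ≤ δ) (hδ1 : δ ≤ 1) (hη : 0 < η) (hN : 0 < N)
    (ha : 0 ≤ a) (hηN : 5 ≤ η * N) :
    Real.log ‖quadrantMajorant δ (a + (η * N : ℝ) * Complex.I)‖
      - Real.log ‖quadrantZeta δ (a + (η * N : ℝ) * Complex.I)‖
      ≤ 10 * (1 + (a + η * N)) ^ (1 / 2 : ℝ) + 3 := by
  set q : ℂ := a + (η * N : ℝ) * Complex.I with hq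
  have hqim : q.im = η * N := by simp [hq]
  have hqre : q.re = a := by simp [hq]
  have hq0 : 0 ≤ q.im := by rw [hqim]; positivity
  have hqn : ‖q‖ ≤ a + η * N := by
    have := Complex.norm_le_abs_re_add_abs_im q
    rwa [hqim, hqre, abs_of_nonneg ha, abs_of_pos (by positivity)] at this
  have h1 := (le_abs_self _).trans (abs_log_norm_quadrantMajorant_le hδ hq0)
  have hre : 3 / 2 ≤ (upperSqrt q).re := by
    obtain ⟨h2, h3⟩ := upperSqrt_re_nonneg_im_nonneg hq0
    have h4 := congrArg Complex.re (upperSqrt_pow_two q)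
    have h5 := congrArg Complex.im (upperSqrt_pow_two q)
    rw [hqre] at h4
    rw [hqim] at h5
    simp [pow_two] at h4 h5
    by_contra hcon
    nlinarith
  have h6 : -Real.log ‖quadrantZeta δ q‖ ≤ 3 := by
    refine neg_log_norm_riemannZeta₁_le ?_
    simp
    linarith
  have h7 : (8 + 2 * δ) * (1 + ‖q‖) ^ (1 / 2 : ℝ) ≤ 10 * (1 + (a + η * N)) ^ (1 / 2 : ℝ) := by
    gcongr
    linarith
  linarith

lemma tendsto_tail_bound (a : ℝ) {η : ℝ} (ha : 0 ≤ a) (hη : 0 < η) :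
    Tendsto (fun N : ℝ => 2 * Real.pi / N * (10 * (1 + (a + η * N)) ^ (1 / 2 : ℝ) + 3)) atTop
      (𝓝 0) := by
  have h1 : Tendsto (fun N : ℝ => N⁻¹) atTop (𝓝 0) := tendsto_inv_atTop_zero
  have h2 : Tendsto (fun N : ℝ => ((1 + a) * (N⁻¹ * N⁻¹) + η * N⁻¹) ^ (1 / 2 : ℝ)) atTop (𝓝 0) := by
    have := (((h1.mul h1).const_mul (1 + a)).add (h1.const_mul η)).rpow_const
      (p := 1 / 2) (Or.inr (by norm_num))
    simpa using this
  have h3 := ((h2.const_mul 10).add (h1.const_mul 3)).const_mul (2 * Real.pi)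
  simp only [mul_zero, add_zero] at h3
  refine h3.congr' ?_
  filter_upwards [eventually_gt_atTop 0] with N hN
  have h4 : (1 + a) * (N⁻¹ * N⁻¹) + η * N⁻¹ = (1 + (a + η * N)) / N ^ 2 := by
    field_simp
    ring
  rw [h4, Real.div_rpow (by positivity) (by positivity), ← Real.rpow_natCast_mul hN.le]
  norm_num
  field_simp

/-- If `ζ` has no zero with real part greater than `1 / 2`, the Poisson formula holds for
`log |(s - 1) ζ(s)|` on the quadrant. -/
lemma log_norm_quadrantZeta_eq_of_ne_zero (hZ : ∀ s : ℂ, 1 / 2 < s.re → riemannZeta₁ s ≠ 0)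
    {a : ℝ} (ha : 0 ≤ a) {η : ℝ} (hη : 0 < η) :
    Real.log ‖quadrantZeta 0 (a + η * Complex.I)‖
      = Real.pi⁻¹ * ∫ x : ℝ, (1 + x ^ 2)⁻¹ * Real.log ‖quadrantZeta 0 (a + η * x : ℝ)‖ := by
  have him : 0 < (a + η * Complex.I : ℂ).im := by simpa using hη
  have hne : quadrantZeta 0 (a + η * Complex.I) ≠ 0 := by
    refine hZ _ ?_
    have := (upperSqrt_re_pos_im_pos him).1
    simpa using this
  obtain ⟨hI, hle⟩ := log_norm_quadrantZeta_add_le le_rfl a hη hne (Or.inl rfl)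
  -- The inequality `≤` is the unconditional one. The converse comes from the shifted formulas as `δ
  -- → 0`.
  refine le_antisymm (by simpa using hle) ?_
  set δ : ℕ → ℝ := fun n => 1 / ((n : ℝ) + 1) with hδ
  have hδ0 : ∀ n, 0 < δ n := fun n => by simp only [hδ]; positivity
  have hδ1 : ∀ n, δ n ≤ 1 := fun n => by
    simp only [hδ]
    exact div_le_one_of_le₀ (by linarith [(Nat.cast_nonneg n : (0 : ℝ) ≤ n)]) (by positivity)
  have hδt : Tendsto δ atTop (𝓝 0) := tendsto_one_div_add_atTop_nhds_zero_nat
  have hpt : Tendsto (fun n => Real.log ‖quadrantZeta (δ n) (a + η * Complex.I)‖) atTop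
      (𝓝 (Real.log ‖quadrantZeta 0 (a + η * Complex.I)‖)) := by
    refine Tendsto.log (Tendsto.norm ?_) (norm_ne_zero_iff.2 hne)
    unfold quadrantZeta
    refine (differentiable_riemannZeta₁.continuous.tendsto _).comp ?_
    exact Tendsto.add_const _ (Tendsto.const_add _ ((Complex.continuous_ofReal.tendsto _).comp hδt))
  -- Tail bound uniform in `δ`: `V = log |E| - log |F| ≥ 0` has tail at most `2π/N` times its value
  -- at height `η N`, which is `O(N^(-1/2))`; and `log |F| ≥ -V` because `log |E| ≥ 0`.
  have htail : ∀ N : ℝ, 1 ≤ N → 5 ≤ η * N → ∀ n,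
      -(2 * Real.pi / N * (10 * (1 + (a + η * N)) ^ (1 / 2 : ℝ) + 3))
        ≤ ∫ x in (Icc (-N) N)ᶜ, (1 + x ^ 2)⁻¹ *
          Real.log ‖quadrantZeta (δ n) (a + η * x : ℝ)‖ := by
    intro N hN hηN n
    have hN0 : 0 < N := by linarith
    set V : ℝ → ℝ := fun v => Real.log ‖quadrantMajorant (δ n) v‖
      - Real.log ‖quadrantZeta (δ n) v‖ with hV
    have hZne : ∀ v : ℝ, quadrantZeta (δ n) v ≠ 0 := fun v => hZ _ (by
      linarith [re_half_add_upperSqrt (δ := δ n) (v := v) (by simp), hδ0 n])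
    have hV0 : ∀ v, 0 ≤ V v := fun v => by
      have := Real.log_le_log (norm_pos_iff.2 (hZne v))
        (norm_quadrantZeta_le (hδ0 n).le (v := v) (by simp))
      simp only [hV]
      linarith
    have hpoisson : ∀ θ : ℝ, 0 < θ → (Integrable fun x : ℝ => (1 + x ^ 2)⁻¹ * V (a + θ * x)) ∧
        Real.log ‖quadrantMajorant (δ n) (a + θ * Complex.I)‖
          - Real.log ‖quadrantZeta (δ n) (a + θ * Complex.I)‖
          = Real.pi⁻¹ * ∫ x : ℝ, (1 + x ^ 2)⁻¹ * V (a + θ * x) := by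
      intro θ hθ
      obtain ⟨hE1, hE2⟩ := log_norm_eq_poisson (differentiableOn_quadrantMajorant (δ n))
        (continuousOn_quadrantMajorant (δ n))
        (fun v hv => quadrantMajorant_ne_zero (hδ0 n).le hv)
        (fun v hv => abs_log_norm_quadrantMajorant_le (hδ0 n).le hv) a hθ
      obtain ⟨hZ1, hZ2⟩ := log_norm_quadrantZeta_eq_poisson hZ (hδ0 n) a hθ
      simp only [hV, mul_sub]
      refine ⟨hE1.sub hZ1, ?_⟩
      rw [integral_sub hE1 hZ1, mul_sub, ← hE2, ← hZ2]
    obtain ⟨h1, -⟩ := hpoisson η hη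
    obtain ⟨h2, h3⟩ := hpoisson (η * N) (by positivity)
    have h4 := setIntegral_compl_Icc_le hV0 a η hN h1 h2
    have h5 := quadrant_excess_le (hδ0 n).le (hδ1 n) hη hN0 ha hηN
    rw [h3, ← div_eq_inv_mul, div_le_iff₀ Real.pi_pos] at h5
    have h6 : ∫ x in (Icc (-N) N)ᶜ, (1 + x ^ 2)⁻¹ * V (a + η * x)
        ≤ 2 * Real.pi / N * (10 * (1 + (a + η * N)) ^ (1 / 2 : ℝ) + 3) := by
      refine h4.trans ?_
      calc _ ≤ 2 / N * ((10 * (1 + (a + η * N)) ^ (1 / 2 : ℝ) + 3) * Real.pi) := by gcongr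
        _ = _ := by ring
    have h7 : -∫ x in (Icc (-N) N)ᶜ, (1 + x ^ 2)⁻¹ * V (a + η * x)
        ≤ ∫ x in (Icc (-N) N)ᶜ, (1 + x ^ 2)⁻¹ *
          Real.log ‖quadrantZeta (δ n) (a + η * x : ℝ)‖ := by
      rw [← integral_neg]
      refine setIntegral_mono_on h1.neg.integrableOn
        (log_norm_quadrantZeta_eq_poisson hZ (hδ0 n) a hη).1.integrableOn
        measurableSet_Icc.compl fun x _ => ?_
      rw [← mul_neg]
      refine mul_le_mul_of_nonneg_left ?_ (by positivity)
      have h8 : 0 ≤ Real.log ‖quadrantMajorant (δ n) (a + η * x : ℝ)‖ := by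
        refine Real.log_nonneg ?_
        rw [quadrantMajorant, norm_mul, norm_pow, Complex.norm_ofNat]
        nlinarith [one_le_norm_base (hδ0 n).le (v := (a + η * x : ℝ)) (by simp)]
      simp only [hV]
      linarith
    linarith
  -- With `N` fixed, `δ → 0` is taken first, by local convergence on `[-N, N]`; `N → ∞` comes
  -- afterwards.
  have hfin : ∀ᶠ N : ℝ in atTop,
      Real.pi⁻¹ * ((∫ x in Icc (-N) N, (1 + x ^ 2)⁻¹ * Real.log ‖quadrantZeta 0 (a + η * x : ℝ)‖)
        - (2 * Real.pi / N * (10 * (1 + (a + η * N)) ^ (1 / 2 : ℝ) + 3)))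
        ≤ Real.log ‖quadrantZeta 0 (a + η * Complex.I)‖ := by
    filter_upwards [eventually_ge_atTop 1, eventually_ge_atTop (5 / η)] with N hN1 hN5
    rw [div_le_iff₀' hη] at hN5
    refine le_of_tendsto_of_tendsto
      (((tendsto_integral_Icc_quadrantZeta a hη (N := N) (by linarith)).sub_const _).const_mul _)
      hpt (Eventually.of_forall fun n => ?_)
    obtain ⟨hZ1, hZ2⟩ := log_norm_quadrantZeta_eq_poisson hZ (hδ0 n) a hη
    simp only
    rw [hZ2, ← integral_add_compl (measurableSet_Icc (a := -N) (b := N)) hZ1]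
    refine mul_le_mul_of_nonneg_left ?_ (by positivity)
    linarith [htail N hN1 hN5 n]
  have hlim : Tendsto (fun N : ℝ => Real.pi⁻¹ *
      ((∫ x in Icc (-N) N, (1 + x ^ 2)⁻¹ * Real.log ‖quadrantZeta 0 (a + η * x : ℝ)‖)
        - (2 * Real.pi / N * (10 * (1 + (a + η * N)) ^ (1 / 2 : ℝ) + 3)))) atTop
      (𝓝 (Real.pi⁻¹ *
        ((∫ x : ℝ, (1 + x ^ 2)⁻¹ * Real.log ‖quadrantZeta 0 (a + η * x : ℝ)‖) - 0))) := by
    refine Tendsto.const_mul _ (Tendsto.sub ?_ (tendsto_tail_bound a ha hη))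
    exact (aecover_Icc tendsto_neg_atTop_atBot tendsto_id).integral_tendsto_of_countably_generated hI
  rw [sub_zero] at hlim
  exact le_of_tendsto hlim hfin

/-! ### Removing the simple pole: principal values and Poisson kernels -/

/-- `U w / w²` with the simple pole `γ / w` at the origin removed. -/
noncomputable def poleRemoved (U : ℝ → ℝ) (γ r w : ℝ) : ℝ :=
  (U w - (Ioo (-r) r).indicator (fun w => γ * w) w) / w ^ 2

section PoleRemoved

variable {U : ℝ → ℝ} {γ r C η₀ : ℝ}

/-- Bounded near `0` by the second-order estimate; for `|w| ≥ r`, `1/w²` is comparable to `1/(w² +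
η₀²)`. -/
lemma integrable_poleRemoved (hUm : Measurable U) (hr : 0 < r)
    (hnear : ∀ w ∈ Ioo (-r) r, |U w - γ * w| ≤ C * w ^ 2)
    (hη₀ : 0 < η₀) (hint : Integrable fun w => U w / (w ^ 2 + η₀ ^ 2)) :
    Integrable (poleRemoved U γ r) := by
  have hm : Measurable (poleRemoved U γ r) := by
    have h1 : Measurable ((Ioo (-r) r).indicator fun w : ℝ => γ * w) :=
      (measurable_const_mul γ).indicator measurableSet_Ioo
    exact (hUm.sub h1).div (measurable_id.pow_const 2)
  have h2 : Integrable ((Ioo (-r) r).indicator fun _ : ℝ => |C|) :=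
    (integrableOn_const (by simp)).integrable_indicator measurableSet_Ioo
  refine (h2.add (hint.norm.const_mul (1 + η₀ ^ 2 / r ^ 2))).mono' hm.aestronglyMeasurable
    (Eventually.of_forall fun w => ?_)
  simp only [Pi.add_apply]
  have h4 : 0 < w ^ 2 + η₀ ^ 2 := by positivity
  rw [Real.norm_eq_abs, Real.norm_eq_abs, abs_div, abs_of_pos h4]
  by_cases hw : w ∈ Ioo (-r) r
  · rw [poleRemoved, indicator_of_mem hw, indicator_of_mem hw, abs_div, abs_of_nonneg (sq_nonneg w)]
    have h5 : |U w - γ * w| / w ^ 2 ≤ |C| :=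
      div_le_of_le_mul₀ (sq_nonneg w) (abs_nonneg C)
        ((hnear w hw).trans (mul_le_mul_of_nonneg_right (le_abs_self C) (sq_nonneg w)))
    have h6 : 0 ≤ (1 + η₀ ^ 2 / r ^ 2) * (|U w| / (w ^ 2 + η₀ ^ 2)) := by positivity
    linarith
  · rw [poleRemoved, indicator_of_notMem hw, indicator_of_notMem hw, sub_zero, zero_add, abs_div,
      abs_of_nonneg (sq_nonneg w)]
    have hw2 : r ^ 2 ≤ w ^ 2 := by
      rw [← sq_abs w]
      refine pow_le_pow_left₀ hr.le ?_ 2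
      by_contra hcon
      exact hw (abs_lt.1 (not_le.1 hcon))
    have hw0 : 0 < w ^ 2 := lt_of_lt_of_le (by positivity) hw2
    rw [mul_div_assoc', div_le_div_iff₀ hw0 h4]
    have h7 : w ^ 2 + η₀ ^ 2 ≤ (1 + η₀ ^ 2 / r ^ 2) * w ^ 2 := by
      have : η₀ ^ 2 ≤ η₀ ^ 2 / r ^ 2 * w ^ 2 := by
        rw [div_mul_eq_mul_div, le_div_iff₀ (by positivity)]
        gcongr
      linarith
    nlinarith [abs_nonneg (U w)]

/-- The subtracted term `γ w` is odd on a symmetric interval, so it integrates to zero against the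
even kernel. What is left is dominated by `poleRemoved`. -/
lemma tendsto_integral_div_sq_add_sq (hUm : Measurable U) (hr : 0 < r)
    (hnear : ∀ w ∈ Ioo (-r) r, |U w - γ * w| ≤ C * w ^ 2)
    (hη₀ : 0 < η₀) (hint : Integrable fun w => U w / (w ^ 2 + η₀ ^ 2)) :
    Tendsto (fun η : ℝ => ∫ w, U w / (w ^ 2 + η ^ 2)) (𝓝[>] 0)
      (𝓝 (∫ w, poleRemoved U γ r w)) := by
  have hΦ := integrable_poleRemoved hUm hr hnear hη₀ hint
  have hU0 : U 0 = 0 := by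
    have := hnear 0 (by simp [hr])
    simpa using this
  have hbd : ∀ η w : ℝ, ‖poleRemoved U γ r w * (w ^ 2 / (w ^ 2 + η ^ 2))‖
      ≤ ‖poleRemoved U γ r w‖ := fun η w => by
    rw [norm_mul]
    refine mul_le_of_le_one_right (norm_nonneg _) ?_
    rw [Real.norm_eq_abs, abs_of_nonneg (by positivity)]
    exact div_le_one_of_le₀ (by nlinarith [sq_nonneg η]) (by positivity)
  have hmeas : ∀ η : ℝ, AEStronglyMeasurable
      (fun w => poleRemoved U γ r w * (w ^ 2 / (w ^ 2 + η ^ 2))) := fun η => by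
    have : Measurable fun w : ℝ => w ^ 2 / (w ^ 2 + η ^ 2) := by fun_prop
    exact hΦ.aestronglyMeasurable.mul this.aestronglyMeasurable
  have hlim : Tendsto (fun η : ℝ => ∫ w, poleRemoved U γ r w * (w ^ 2 / (w ^ 2 + η ^ 2))) (𝓝[>] 0)
      (𝓝 (∫ w, poleRemoved U γ r w)) := by
    refine tendsto_integral_filter_of_dominated_convergence (fun w => ‖poleRemoved U γ r w‖)
      (Eventually.of_forall hmeas) (Eventually.of_forall fun η => Eventually.of_forall (hbd η))
      hΦ.norm ?_
    have hae : ∀ᵐ w : ℝ, w ≠ 0 := by simp [ae_iff]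
    filter_upwards [hae] with w hw
    have h1 : ContinuousAt (fun η : ℝ => poleRemoved U γ r w * (w ^ 2 / (w ^ 2 + η ^ 2))) 0 := by
      have : w ^ 2 + (0 : ℝ) ^ 2 ≠ 0 := by positivity
      fun_prop (disch := assumption)
    have h2 := h1.tendsto.mono_left (nhdsWithin_le_nhds (s := Ioi 0))
    simpa [div_self (pow_ne_zero 2 hw)] using h2
  refine hlim.congr' ?_
  filter_upwards [self_mem_nhdsWithin] with η hη
  have hη0 : 0 < η := hη
  set J : ℝ → ℝ := (Ioo (-r) r).indicator fun w => γ * w / (w ^ 2 + η ^ 2) with hJ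
  have hJint : Integrable J := by
    refine IntegrableOn.integrable_indicator ?_ measurableSet_Ioo
    have : Continuous fun w : ℝ => γ * w / (w ^ 2 + η ^ 2) := by
      have : ∀ w : ℝ, w ^ 2 + η ^ 2 ≠ 0 := fun w => by positivity
      fun_prop (disch := assumption)
    exact (this.integrableOn_Icc (a := -r) (b := r)).mono_set Ioo_subset_Icc_self
  have hJodd : ∀ w, J (-w) = -J w := fun w => by
    simp only [hJ]
    by_cases hw : w ∈ Ioo (-r) r
    · rw [indicator_of_mem hw, indicator_of_mem (by constructor <;> linarith [hw.1, hw.2])]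
      ring
    · rw [indicator_of_notMem hw, indicator_of_notMem, neg_zero]
      intro h
      exact hw (by constructor <;> linarith [h.1, h.2])
  have hJ0 : ∫ w, J w = 0 := by
    have h1 := integral_neg_eq_self J volume
    simp only [hJodd, integral_neg] at h1
    linarith
  have hsum : ∀ w, U w / (w ^ 2 + η ^ 2)
      = poleRemoved U γ r w * (w ^ 2 / (w ^ 2 + η ^ 2)) + J w := fun w => by
    rcases eq_or_ne w 0 with rfl | hw
    · simp [hU0, hJ, indicator]
    · by_cases hw' : w ∈ Ioo (-r) r
      · simp only [hJ, poleRemoved, indicator_of_mem hw']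
        field_simp
        ring
      · simp only [hJ, poleRemoved, indicator_of_notMem hw']
        field_simp
        ring
  simp only [hsum]
  rw [integral_add (hΦ.norm.mono' (hmeas η) (Eventually.of_forall (hbd η))) hJint, hJ0, add_zero]

lemma div_sq_eq_poleRemoved_add {w : ℝ} (hw : w ≠ 0) :
    U w / w ^ 2 = poleRemoved U γ r w + (Ioo (-r) r).indicator (fun w => γ * w⁻¹) w := by
  by_cases hw' : w ∈ Ioo (-r) r
  · simp only [poleRemoved, indicator_of_mem hw']
    field_simp
    ring
  · simp only [poleRemoved, indicator_of_notMem hw']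
    ring

lemma integrableOn_indicator_inv {a : ℝ} (ha : 0 < a) {s : Set ℝ} (hs : MeasurableSet s)
    (hsa : ∀ w ∈ s, a ≤ |w|) :
    IntegrableOn ((Ioo (-r) r).indicator fun w => γ * w⁻¹) s := by
  have h1 : IntegrableOn (fun w : ℝ => γ * w⁻¹) (s ∩ Ioo (-r) r) := by
    refine Measure.integrableOn_of_bounded (M := |γ| * a⁻¹) ?_ ?_ ?_
    · exact ((measure_mono inter_subset_right).trans_lt (by simp)).ne
    · exact (measurable_inv.const_mul γ).aestronglyMeasurable
    · filter_upwards [ae_restrict_mem (hs.inter measurableSet_Ioo)] with w hw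
      rw [norm_mul, norm_inv, Real.norm_eq_abs, Real.norm_eq_abs]
      have := hsa w hw.1
      gcongr
  rw [IntegrableOn, integrable_indicator_iff measurableSet_Ioo, IntegrableOn,
    Measure.restrict_restrict measurableSet_Ioo, inter_comm]
  exact h1

lemma integrableOn_div_sq {a : ℝ} (ha : 0 < a) {s : Set ℝ} (hs : MeasurableSet s)
    (hsa : ∀ w ∈ s, a ≤ |w|) (hΦ : Integrable (poleRemoved U γ r)) :
    IntegrableOn (fun w => U w / w ^ 2) s := by
  refine IntegrableOn.congr_fun (hΦ.integrableOn.add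
    (integrableOn_indicator_inv (γ := γ) (r := r) ha hs hsa))
    (fun w hw => ?_) hs
  have hw0 : w ≠ 0 := by
    rintro rfl
    have := hsa 0 hw
    simp at this
    linarith
  exact (div_sq_eq_poleRemoved_add hw0).symm

lemma setIntegral_div_sq {a : ℝ} (ha : 0 < a) {s : Set ℝ} (hs : MeasurableSet s)
    (hsa : ∀ w ∈ s, a ≤ |w|) (hΦ : Integrable (poleRemoved U γ r)) :
    ∫ w in s, U w / w ^ 2 = (∫ w in s, poleRemoved U γ r w)
      + γ * ∫ w in s ∩ Ioo (-r) r, w⁻¹ := by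
  rw [← integral_const_mul, ← setIntegral_indicator measurableSet_Ioo,
    ← integral_add hΦ.integrableOn (integrableOn_indicator_inv ha hs hsa)]
  refine setIntegral_congr_fun hs fun w hw => div_sq_eq_poleRemoved_add ?_
  rintro rfl
  have := hsa 0 hw
  simp at this
  linarith

/-- The hole is the image of `(1 - ε, 1 + ε)` under `x ↦ x (x - 1)`. It is not symmetric, but its
ends have ratio tending to `1` in modulus, so the pole leaves only `γ log ((1 - ε)/(1 + ε)) → 0`.
The bound on `r` keeps `(-r, r)` inside `(-1/4, ∞)`. -/
lemma tendsto_principalValue_div_sq (hr : 0 < r) (hr1 : r ≤ 1 / 8)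
    (hΦ : Integrable (poleRemoved U γ r)) :
    Tendsto (fun ε : ℝ => (∫ w in Ioo (-1 / 4) (-(ε - ε ^ 2)), U w / w ^ 2)
        + ∫ w in Ioi (ε + ε ^ 2), U w / w ^ 2) (𝓝[>] 0)
      (𝓝 (∫ w in Ioi (-1 / 4), poleRemoved U γ r w)) := by
  have hlog : Tendsto (fun ε : ℝ => γ * Real.log ((1 - ε) / (1 + ε))) (𝓝[>] 0) (𝓝 0) := by
    have h0 : ContinuousAt (fun ε : ℝ => (1 - ε) / (1 + ε)) 0 := by
      fun_prop (disch := norm_num)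
    have h1 := (h0.tendsto.log (by norm_num)).const_mul γ
    simpa using h1.mono_left (nhdsWithin_le_nhds (s := Ioi 0))
  have hset : Tendsto (fun ε : ℝ => (∫ w in Ioo (-1 / 4) (-(ε - ε ^ 2)), poleRemoved U γ r w)
      + ∫ w in Ioi (ε + ε ^ 2), poleRemoved U γ r w) (𝓝[>] 0)
      (𝓝 (∫ w in Ioi (-1 / 4), poleRemoved U γ r w)) := by
    have h0 : Tendsto (fun ε : ℝ => ∫ w, (Ioo (-1 / 4) (-(ε - ε ^ 2)) ∪ Ioi (ε + ε ^ 2)).indicator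
        (poleRemoved U γ r) w) (𝓝[>] 0) (𝓝 (∫ w, (Ioi (-1 / 4)).indicator (poleRemoved U γ r) w)) := by
      refine tendsto_integral_filter_of_dominated_convergence (fun w => ‖poleRemoved U γ r w‖)
        (Eventually.of_forall fun ε => (hΦ.indicator
          (measurableSet_Ioo.union measurableSet_Ioi)).aestronglyMeasurable)
        (Eventually.of_forall fun ε => Eventually.of_forall fun w =>
          norm_indicator_le_norm_self _ _) hΦ.norm ?_
      have hae : ∀ᵐ w : ℝ, w ≠ 0 := by simp [ae_iff]
      filter_upwards [hae] with w hw
      have hc1 : Tendsto (fun ε : ℝ => -(ε - ε ^ 2)) (𝓝[>] 0) (𝓝 0) := by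
        have : ContinuousAt (fun ε : ℝ => -(ε - ε ^ 2)) 0 := by fun_prop
        simpa using this.tendsto.mono_left (nhdsWithin_le_nhds (s := Ioi 0))
      have hc2 : Tendsto (fun ε : ℝ => ε + ε ^ 2) (𝓝[>] 0) (𝓝 0) := by
        have : ContinuousAt (fun ε : ℝ => ε + ε ^ 2) 0 := by fun_prop
        simpa using this.tendsto.mono_left (nhdsWithin_le_nhds (s := Ioi 0))
      refine tendsto_const_nhds.congr' ?_
      filter_upwards [Ioo_mem_nhdsGT (show (0 : ℝ) < 1 / 2 by norm_num),
        (hw.lt_or_gt.elim (fun h => (hc1.eventually_const_lt h).mono fun _ => Or.inl)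
          fun h => (hc2.eventually_lt_const h).mono fun _ => Or.inr :
          ∀ᶠ ε : ℝ in 𝓝[>] 0, w < -(ε - ε ^ 2) ∨ ε + ε ^ 2 < w)] with ε hε hεw
      by_cases hw4 : w ∈ Ioi (-1 / 4)
      · rw [indicator_of_mem hw4, indicator_of_mem]
        exact hεw.imp (fun h => ⟨hw4, h⟩) id
      · rw [indicator_of_notMem hw4, indicator_of_notMem]
        rintro (h | h)
        · exact hw4 h.1
        · have h' : ε + ε ^ 2 < w := h
          refine hw4 (show -1 / 4 < w from ?_)
          nlinarith [hε.1]
    rw [integral_indicator measurableSet_Ioi] at h0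
    refine h0.congr' ?_
    filter_upwards [Ioo_mem_nhdsGT (show (0 : ℝ) < 1 / 2 by norm_num)] with ε hε
    rw [integral_indicator (measurableSet_Ioo.union measurableSet_Ioi),
      setIntegral_union ?_ measurableSet_Ioi hΦ.integrableOn hΦ.integrableOn]
    refine disjoint_left.2 fun w h1 h2 => ?_
    have h3 : ε + ε ^ 2 < w := h2
    nlinarith [h1.2, hε.1]
  have hadd := hset.add hlog
  rw [add_zero] at hadd
  refine hadd.congr' ?_
  filter_upwards [Ioo_mem_nhdsGT (show (0 : ℝ) < r / 2 by positivity)] with ε hε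
  obtain ⟨hε0, hεr⟩ := hε
  have ha : 0 < ε - ε ^ 2 := by nlinarith
  have hb : 0 < ε + ε ^ 2 := by positivity
  have har : ε - ε ^ 2 < r := by nlinarith
  have hbr : ε + ε ^ 2 < r := by nlinarith
  rw [setIntegral_div_sq ha measurableSet_Ioo (fun w hw => ?_) hΦ,
    setIntegral_div_sq hb measurableSet_Ioi (fun w hw => ?_) hΦ]
  rotate_left
  · exact (le_of_lt hw).trans (le_abs_self w)
  · rw [abs_of_neg (by linarith [hw.2])]
    linarith [hw.2]
  have h1 : Ioo (-1 / 4) (-(ε - ε ^ 2)) ∩ Ioo (-r) r = Ioo (-r) (-(ε - ε ^ 2)) := by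
    rw [Ioo_inter_Ioo]
    congr 1
    · exact sup_eq_right.2 (by linarith)
    · exact inf_eq_left.2 (by linarith)
  have h2 : Ioi (ε + ε ^ 2) ∩ Ioo (-r) r = Ioo (ε + ε ^ 2) r := by
    ext w
    simp only [mem_inter_iff, mem_Ioi, mem_Ioo]
    constructor
    · rintro ⟨h, -, h'⟩
      exact ⟨h, h'⟩
    · rintro ⟨h, h'⟩
      exact ⟨h, by linarith, h'⟩
  have h3 : ∫ w in Ioo (-r) (-(ε - ε ^ 2)), w⁻¹ = Real.log ((ε - ε ^ 2) / r) := by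
    rw [← integral_Ioc_eq_integral_Ioo, ← intervalIntegral.integral_of_le (by linarith),
      integral_inv_of_neg (by linarith) (by linarith), neg_div_neg_eq]
  have h4 : ∫ w in Ioo (ε + ε ^ 2) r, w⁻¹ = Real.log (r / (ε + ε ^ 2)) := by
    rw [← integral_Ioc_eq_integral_Ioo, ← intervalIntegral.integral_of_le (by linarith),
      integral_inv_of_pos hb hr]
  have h5 : Real.log ((ε - ε ^ 2) / r) + Real.log (r / (ε + ε ^ 2))
      = Real.log ((1 - ε) / (1 + ε)) := by
    rw [← Real.log_mul (by positivity) (by positivity)]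
    congr 1
    field_simp
  rw [h1, h2, h3, h4, ← h5]
  ring

end PoleRemoved

/-! ### The boundary function and its Poisson integrals at `1/4 + iη` -/

/-- `log |(s - 1) ζ(s)|` on the boundary of the quadrant, in terms of `w = s (s - 1)`. -/
noncomputable def boundaryLog (w : ℝ) : ℝ := Real.log ‖quadrantZeta 0 ((1 / 4 + w : ℝ) : ℂ)‖

lemma measurable_boundaryLog : Measurable boundaryLog := by
  have := measurable_comp_ofReal (continuousOn_quadrantZeta 0) (1 / 4) 1
  simp only [one_mul] at this
  exact this.norm.log

lemma upperSqrt_quarter : upperSqrt (1 / 4) = 1 / 2 := by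
  have := upperSqrt_of_sq_eq (v := 1 / 4) (w := 1 / 2) (by simp) (by norm_num) (by simp) (by simp)
  exact this

lemma quadrantZeta_quarter : quadrantZeta 0 (1 / 4) = 1 := by
  rw [quadrantZeta, upperSqrt_quarter]
  norm_num

lemma hasDerivAt_quadrantZeta_quarter :
    HasDerivAt (quadrantZeta 0) (Real.eulerMascheroniConstant : ℂ) (1 / 4) := by
  have h1 : DifferentiableAt ℂ upperSqrt (1 / 4) := differentiableAt_upperSqrt (Or.inr (by norm_num))
  have h2 : deriv upperSqrt (1 / 4) = 1 := by
    have h3 := h1.hasDerivAt.pow 2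
    have h4 : HasDerivAt (fun v => upperSqrt v ^ 2) 1 (1 / 4) := by
      simp only [upperSqrt_pow_two]
      exact hasDerivAt_id' _
    have h5 := h3.unique h4
    rw [upperSqrt_quarter] at h5
    norm_num at h5
    exact h5
  have h3 : HasDerivAt (fun v => (1 / 2 + (0 : ℝ) + upperSqrt v : ℂ)) 1 (1 / 4) :=
    (h2 ▸ h1.hasDerivAt).const_add _
  have h4 : HasDerivAt riemannZeta₁ (Real.eulerMascheroniConstant : ℂ)
      ((fun v => (1 / 2 + (0 : ℝ) + upperSqrt v : ℂ)) (1 / 4)) := by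
    have h5 := (differentiable_riemannZeta₁ 1).hasDerivAt
    rw [deriv_riemannZeta₁_one] at h5
    have h7 : (1 / 2 + (0 : ℝ) + upperSqrt (1 / 4) : ℂ) = 1 := by
      rw [upperSqrt_quarter]
      norm_num
    show HasDerivAt riemannZeta₁ _ (1 / 2 + (0 : ℝ) + upperSqrt (1 / 4) : ℂ)
    rw [h7]
    exact h5
  have h6 := h4.comp (1 / 4) h3
  rw [mul_one] at h6
  exact h6

/-- A function holomorphic near `z₀` agrees with its tangent to second order. -/
lemma AnalyticAt.exists_norm_sub_le {h : ℂ → ℂ} {z₀ : ℂ} (hh : AnalyticAt ℂ h z₀) :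
    ∃ C : ℝ, ∀ᶠ z in 𝓝 z₀, ‖h z - h z₀ - (z - z₀) * deriv h z₀‖ ≤ C * ‖z - z₀‖ ^ 2 := by
  obtain ⟨p, hp⟩ := hh
  have h1 : AnalyticAt ℂ (dslope h z₀) z₀ := ⟨_, hp.has_fpower_series_dslope_fslope⟩
  obtain ⟨C, hC⟩ := h1.differentiableAt.isBigO_sub.bound
  refine ⟨C, hC.mono fun z hz => ?_⟩
  have h2 : h z - h z₀ - (z - z₀) * deriv h z₀
      = (z - z₀) * (dslope h z₀ z - dslope h z₀ z₀) := by
    have := sub_smul_dslope h z₀ z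
    rw [smul_eq_mul] at this
    rw [mul_sub, this, dslope_same]
  rw [h2, norm_mul, pow_two, mul_left_comm]
  gcongr

/-- Real part of the second-order Taylor expansion of `log F` at `s = 1`, where `F = 1` and `dF/dw =
γ`. It is stated for complex `w` to serve both on the boundary and at `w = iη`, where the linear
term vanishes. -/
lemma exists_log_norm_quadrantZeta_near :
    ∃ C r : ℝ, 0 < r ∧ r ≤ 1 / 8 ∧ ∀ w : ℂ, ‖w‖ < r → quadrantZeta 0 (1 / 4 + w) ≠ 0 ∧
      |Real.log ‖quadrantZeta 0 (1 / 4 + w)‖ - Real.eulerMascheroniConstant * w.re|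
        ≤ C * ‖w‖ ^ 2 := by
  have han : AnalyticAt ℂ (quadrantZeta 0) (1 / 4) := by
    have hopen : IsOpen {v : ℂ | 0 < v.re} := isOpen_lt continuous_const Complex.continuous_re
    refine DifferentiableOn.analyticAt (s := {v : ℂ | 0 < v.re}) (fun v hv => ?_)
      (hopen.mem_nhds (by norm_num))
    have h1 := differentiableAt_upperSqrt (Or.inr hv)
    have h2 : DifferentiableAt ℂ (fun v => (1 / 2 + (0 : ℝ) + upperSqrt v : ℂ)) v := h1.const_add _
    exact (differentiable_riemannZeta₁.differentiableAt.comp v h2).differentiableWithinAt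
  have hslit : quadrantZeta 0 (1 / 4) ∈ Complex.slitPlane := by
    rw [quadrantZeta_quarter]
    exact Complex.one_mem_slitPlane
  have hlog : AnalyticAt ℂ (fun v => Complex.log (quadrantZeta 0 v)) (1 / 4) := han.clog hslit
  have hder : deriv (fun v => Complex.log (quadrantZeta 0 v)) (1 / 4)
      = (Real.eulerMascheroniConstant : ℂ) := by
    rw [(hasDerivAt_quadrantZeta_quarter.clog hslit).deriv, quadrantZeta_quarter, div_one]
  obtain ⟨C, hC⟩ := hlog.exists_norm_sub_le
  rw [hder, quadrantZeta_quarter, Complex.log_one] at hC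
  have hne := han.continuousAt.eventually_ne (y := 0) (by rw [quadrantZeta_quarter]; exact one_ne_zero)
  obtain ⟨r, hr, hball⟩ := Metric.eventually_nhds_iff_ball.1 (hC.and hne)
  refine ⟨C, min r (1 / 8), by positivity, min_le_right _ _, fun w hw => ?_⟩
  obtain ⟨h1, h2⟩ := hball (1 / 4 + w) (by
    rw [mem_ball_iff_norm, add_sub_cancel_left]
    exact hw.trans_le (min_le_left _ _))
  refine ⟨h2, ?_⟩
  rw [add_sub_cancel_left] at h1
  refine le_trans ?_ h1
  refine le_trans (le_of_eq ?_) (Complex.abs_re_le_norm _)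
  congr 1
  rw [sub_zero, Complex.sub_re, Complex.log_re, mul_comm w, Complex.re_ofReal_mul]

lemma integral_inv_one_add_sq_mul {V : ℝ → ℝ} {η : ℝ} (hη : 0 < η) :
    ∫ x : ℝ, (1 + x ^ 2)⁻¹ * V (η * x) = η * ∫ w : ℝ, V w / (w ^ 2 + η ^ 2) := by
  have h1 := Measure.integral_comp_div (fun x : ℝ => (1 + x ^ 2)⁻¹ * V (η * x)) η
  have h2 : ∀ w : ℝ, (1 + (w / η) ^ 2)⁻¹ * V (η * (w / η)) = η ^ 2 * (V w / (w ^ 2 + η ^ 2)) := by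
    intro w
    rw [mul_div_cancel₀ _ hη.ne']
    field_simp
    ring
  simp only [h2] at h1
  rw [integral_const_mul, abs_of_pos hη, smul_eq_mul] at h1
  refine mul_left_cancel₀ hη.ne' ?_
  rw [← h1]
  ring

lemma integrable_div_sq_add_sq {V : ℝ → ℝ} {η : ℝ} (hη : 0 < η)
    (h : Integrable fun x : ℝ => (1 + x ^ 2)⁻¹ * V (η * x)) :
    Integrable fun w : ℝ => V w / (w ^ 2 + η ^ 2) := by
  have h1 := (h.comp_div hη.ne').const_mul (η ^ 2)⁻¹
  refine h1.congr (Eventually.of_forall fun w => ?_)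
  simp only
  rw [mul_div_cancel₀ _ hη.ne']
  field_simp
  ring

lemma quarter_add_mul_I (η : ℝ) :
    (((1 / 4 : ℝ) : ℂ) + η * Complex.I) = 1 / 4 + η * Complex.I := by
  norm_num

lemma integrable_boundaryLog {η : ℝ} (hη : 0 < η)
    (hne : quadrantZeta 0 (1 / 4 + η * Complex.I) ≠ 0) :
    Integrable fun w => boundaryLog w / (w ^ 2 + η ^ 2) :=
  integrable_div_sq_add_sq hη (log_norm_quadrantZeta_add_le le_rfl (1 / 4) hη
    (by rwa [quarter_add_mul_I]) (Or.inl rfl)).1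

lemma log_norm_add_le_integral_boundaryLog {η : ℝ} (hη : 0 < η)
    (hne : quadrantZeta 0 (1 / 4 + η * Complex.I) ≠ 0) {q : ℂ} (hq : 0 < q.im)
    (hq0 : quadrantZeta 0 q = 0) :
    Real.log ‖quadrantZeta 0 (1 / 4 + η * Complex.I)‖ + Real.log
      ‖(q - (1 / 4 + η * Complex.I)) / (q - (1 / 4 - η * Complex.I))‖⁻¹
      ≤ Real.pi⁻¹ * (η * ∫ w, boundaryLog w / (w ^ 2 + η ^ 2)) := by
  have h := (log_norm_quadrantZeta_add_le le_rfl (1 / 4) hη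
    (by rwa [quarter_add_mul_I]) (Or.inr ⟨q, hq, hq0, rfl⟩)).2
  rw [← integral_inv_one_add_sq_mul hη]
  rw [show (((1 / 4 : ℝ)) : ℂ) = 1 / 4 by norm_num] at h
  exact h

lemma log_norm_eq_integral_boundaryLog (hZ : ∀ s : ℂ, 1 / 2 < s.re → riemannZeta₁ s ≠ 0)
    {η : ℝ} (hη : 0 < η) :
    Real.log ‖quadrantZeta 0 (1 / 4 + η * Complex.I)‖
      = Real.pi⁻¹ * (η * ∫ w, boundaryLog w / (w ^ 2 + η ^ 2)) := by
  have h := log_norm_quadrantZeta_eq_of_ne_zero hZ (a := 1 / 4) (by norm_num) hη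
  rw [quarter_add_mul_I] at h
  rw [h, ← integral_inv_one_add_sq_mul hη]
  rfl

/-- By `log t ≤ t - 1` applied to the squared modulus, whose defect from `1` is `4 Im q · η / |q -
p̄|²`; `η ≤ 1` makes the constant independent of `η`. -/
lemma le_log_norm_inv {q : ℂ} (hq : 0 < q.im) {η : ℝ} (hη : 0 < η) (hη1 : η ≤ 1)
    (hne : q ≠ 1 / 4 + η * Complex.I) :
    2 * q.im / ((q.re - 1 / 4) ^ 2 + (q.im + 1) ^ 2) * η
      ≤ Real.log ‖(q - (1 / 4 + η * Complex.I)) / (q - (1 / 4 - η * Complex.I))‖⁻¹ := by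
  have h1 : ‖q - (1 / 4 + η * Complex.I)‖ ^ 2 = (q.re - 1 / 4) ^ 2 + (q.im - η) ^ 2 := by
    rw [← Complex.normSq_eq_norm_sq, Complex.normSq_apply]
    simp
    ring
  have h2 : ‖q - (1 / 4 - η * Complex.I)‖ ^ 2 = (q.re - 1 / 4) ^ 2 + (q.im + η) ^ 2 := by
    rw [← Complex.normSq_eq_norm_sq, Complex.normSq_apply]
    simp
    ring
  have h3 : 0 < ‖q - (1 / 4 + η * Complex.I)‖ ^ 2 := by
    have := norm_pos_iff.2 (sub_ne_zero.2 hne)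
    positivity
  have h4 : 0 < ‖q - (1 / 4 - η * Complex.I)‖ ^ 2 := by
    rw [h2]
    positivity
  have h5 : Real.log ‖(q - (1 / 4 + η * Complex.I)) / (q - (1 / 4 - η * Complex.I))‖⁻¹
      = -(1 / 2) * Real.log (‖q - (1 / 4 + η * Complex.I)‖ ^ 2 /
        ‖q - (1 / 4 - η * Complex.I)‖ ^ 2) := by
    rw [Real.log_inv, norm_div, ← div_pow, Real.log_pow]
    push_cast
    ring
  have h6 := Real.log_le_sub_one_of_pos (div_pos h3 h4)
  have h7 : ‖q - (1 / 4 + η * Complex.I)‖ ^ 2 / ‖q - (1 / 4 - η * Complex.I)‖ ^ 2 - 1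
      = -(4 * q.im * η / ((q.re - 1 / 4) ^ 2 + (q.im + η) ^ 2)) := by
    rw [h2] at h4
    rw [h1, h2]
    field_simp
    ring
  have h8 : 4 * q.im * η / ((q.re - 1 / 4) ^ 2 + (q.im + 1) ^ 2)
      ≤ 4 * q.im * η / ((q.re - 1 / 4) ^ 2 + (q.im + η) ^ 2) := by
    gcongr
  rw [h5]
  have h9 : 2 * q.im / ((q.re - 1 / 4) ^ 2 + (q.im + 1) ^ 2) * η
      = 1 / 2 * (4 * q.im * η / ((q.re - 1 / 4) ^ 2 + (q.im + 1) ^ 2)) := by ring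
  rw [h9]
  linarith

/-! ### Change of variables `w = s (s - 1)` on both boundary rays -/

lemma image_neg_sq_sub_Ioi : (fun t : ℝ => -1 / 4 - t ^ 2) '' Ioi 0 = Iio (-1 / 4) := by
  ext w
  simp only [mem_image, mem_Ioi, mem_Iio]
  constructor
  · rintro ⟨t, ht, rfl⟩
    nlinarith [pow_pos ht 2]
  · intro hw
    refine ⟨√(-1 / 4 - w), Real.sqrt_pos.2 (by linarith), ?_⟩
    rw [Real.sq_sqrt (by linarith)]
    ring

lemma image_mul_sub_one_Ioi {α : ℝ} (hα : 1 / 2 ≤ α) :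
    (fun x : ℝ => x * (x - 1)) '' Ioi α = Ioi (α * (α - 1)) := by
  ext w
  simp only [mem_image, mem_Ioi]
  constructor
  · rintro ⟨x, hx, rfl⟩
    nlinarith
  · intro hw
    have h0 : 0 ≤ w + 1 / 4 := by nlinarith [sq_nonneg (α - 1 / 2)]
    have h1 := Real.sq_sqrt h0
    refine ⟨1 / 2 + √(w + 1 / 4), ?_, by nlinarith⟩
    have : α - 1 / 2 < √(w + 1 / 4) := Real.lt_sqrt_of_sq_lt (by nlinarith)
    linarith

lemma image_mul_sub_one_Ioo {β : ℝ} (hβ : 1 / 2 ≤ β) :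
    (fun x : ℝ => x * (x - 1)) '' Ioo (1 / 2) β = Ioo (-1 / 4) (β * (β - 1)) := by
  ext w
  simp only [mem_image, mem_Ioo]
  constructor
  · rintro ⟨x, ⟨hx, hx'⟩, rfl⟩
    constructor <;> nlinarith
  · rintro ⟨hw, hw'⟩
    have h0 : 0 < w + 1 / 4 := by linarith
    have h1 := Real.sq_sqrt h0.le
    have h2 := Real.sqrt_pos.2 h0
    refine ⟨1 / 2 + √(w + 1 / 4), ⟨by linarith, ?_⟩, by nlinarith⟩
    have : √(w + 1 / 4) < β - 1 / 2 ∨ β - 1 / 2 ≤ √(w + 1 / 4) := lt_or_ge _ _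
    rcases this with h | h
    · linarith
    · nlinarith

lemma injOn_mul_sub_one : InjOn (fun x : ℝ => x * (x - 1)) (Ici (1 / 2)) := by
  intro x hx y hy h
  simp only [mem_Ici] at hx hy h
  rcases lt_trichotomy x y with hlt | heq | hlt
  · nlinarith
  · exact heq
  · nlinarith

lemma injOn_neg_sq_sub : InjOn (fun t : ℝ => -1 / 4 - t ^ 2) (Ioi 0) := by
  intro x hx y hy h
  simp only [mem_Ioi] at hx hy h
  nlinarith [sq_nonneg (x - y)]

/-- At `s = 1/2 + it` one has `w = -(t² + 1/4)` and `|dw| = 2t dt`, whence the factor `2`. -/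
lemma criticalLineIntegrand_eq {t : ℝ} (ht : 0 < t) :
    |-(2 * t)| • (boundaryLog (-1 / 4 - t ^ 2) / (-1 / 4 - t ^ 2) ^ 2)
      = 2 * criticalLineIntegrand t := by
  have h1 : (1 / 4 + (-1 / 4 - t ^ 2) : ℝ) = -t ^ 2 := by ring
  have h2 : (1 / 2 + t * Complex.I : ℂ) ≠ 1 := by
    intro h
    have := congrArg Complex.re h
    norm_num at this
  have h3 : riemannZeta (1 / 2 + t * Complex.I) * (-1 / 2 + t * Complex.I)
      = quadrantZeta 0 ((-t ^ 2 : ℝ) : ℂ) := by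
    rw [quadrantZeta, upperSqrt_neg_sq ht.le, Complex.ofReal_zero, add_zero, riemannZeta₁_eq_mul h2]
    ring
  rw [abs_neg, abs_of_pos (by positivity), smul_eq_mul, criticalLineIntegrand, boundaryLog, h1, h3]
  rw [show (-1 / 4 - t ^ 2) ^ 2 = (t ^ 2 + 1 / 4) ^ 2 by ring]
  ring

/-- Here `dw = (2x - 1) dx`. The point `x = 1` is excluded because `ζ(x)(x - 1)` is `0` there,
whereas the entire function equals `1`. -/
lemma realAxisIntegrand_eq {x : ℝ} (hx : 1 / 2 < x) (hx1 : x ≠ 1) :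
    |2 * x - 1| • (boundaryLog (x * (x - 1)) / (x * (x - 1)) ^ 2) = 2 * realAxisIntegrand x := by
  have h1 : (1 / 4 + x * (x - 1) : ℝ) = (x - 1 / 2) ^ 2 := by ring
  have h2 : (x : ℂ) ≠ 1 := by exact_mod_cast hx1
  have h3 : riemannZeta x * (x - 1) = quadrantZeta 0 (((x - 1 / 2) ^ 2 : ℝ) : ℂ) := by
    rw [quadrantZeta, upperSqrt_ofReal_of_nonneg (sq_nonneg _), Real.sqrt_sq (by linarith)]
    have : (1 / 2 + (0 : ℝ) + (x - 1 / 2 : ℝ) : ℂ) = x := by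
      push_cast
      ring
    rw [this, riemannZeta₁_eq_mul h2, mul_comm]
  rw [abs_of_pos (by linarith), smul_eq_mul, realAxisIntegrand, boundaryLog, h1, h3, mul_pow]
  ring

lemma hasDerivWithinAt_mul_sub_one (x : ℝ) (s : Set ℝ) :
    HasDerivWithinAt (fun x : ℝ => x * (x - 1)) (2 * x - 1) s x := by
  have := ((hasDerivAt_id' x).mul ((hasDerivAt_id' x).sub_const 1))
  exact (this.congr_deriv (by ring)).hasDerivWithinAt

lemma hasDerivWithinAt_neg_sq_sub (t : ℝ) (s : Set ℝ) :
    HasDerivWithinAt (fun t : ℝ => -1 / 4 - t ^ 2) (-(2 * t)) s t := by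
  have := ((hasDerivAt_id' t).pow 2).const_sub (-1 / 4)
  exact (this.congr_deriv (by norm_num)).hasDerivWithinAt

lemma integrableOn_realAxisIntegrand {s : Set ℝ} (hs : MeasurableSet s)
    (hs1 : ∀ x ∈ s, 1 / 2 < x ∧ x ≠ 1)
    (h : IntegrableOn (fun w => boundaryLog w / w ^ 2) ((fun x : ℝ => x * (x - 1)) '' s)) :
    IntegrableOn realAxisIntegrand s := by
  rw [integrableOn_image_iff_integrableOn_abs_deriv_smul hs
    (fun x _ => hasDerivWithinAt_mul_sub_one x s)
    (injOn_mul_sub_one.mono fun x hx => (hs1 x hx).1.le)] at h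
  refine IntegrableOn.congr_fun (h.const_mul (1 / 2)) (fun x hx => ?_) hs
  simp only [realAxisIntegrand_eq (hs1 x hx).1 (hs1 x hx).2]
  ring

lemma setIntegral_realAxisIntegrand {s : Set ℝ} (hs : MeasurableSet s)
    (hs1 : ∀ x ∈ s, 1 / 2 < x ∧ x ≠ 1) :
    ∫ x in s, realAxisIntegrand x
      = 1 / 2 * ∫ w in (fun x : ℝ => x * (x - 1)) '' s, boundaryLog w / w ^ 2 := by
  rw [integral_image_eq_integral_abs_deriv_smul hs
    (fun x _ => hasDerivWithinAt_mul_sub_one x s)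
    (injOn_mul_sub_one.mono fun x hx => (hs1 x hx).1.le), ← integral_const_mul]
  refine setIntegral_congr_fun hs fun x hx => ?_
  simp only [realAxisIntegrand_eq (hs1 x hx).1 (hs1 x hx).2]
  ring

/-! ### The criterion and the conclusion -/

/-- The integral of `boundaryLog w / w²`, regularized at the origin, vanishes exactly under the
Riemann hypothesis. -/
lemma integral_poleRemoved_eq_zero_iff {C r η₀ : ℝ} (hr : 0 < r)
    (hnear : ∀ w : ℂ, ‖w‖ < r → quadrantZeta 0 (1 / 4 + w) ≠ 0 ∧
      |Real.log ‖quadrantZeta 0 (1 / 4 + w)‖ - Real.eulerMascheroniConstant * w.re| ≤ C * ‖w‖ ^ 2)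
    (hη₀ : 0 < η₀) (hint : Integrable fun w => boundaryLog w / (w ^ 2 + η₀ ^ 2))
    (hnear' : ∀ w ∈ Ioo (-r) r, |boundaryLog w - Real.eulerMascheroniConstant * w| ≤ C * w ^ 2) :
    ∫ w, poleRemoved boundaryLog Real.eulerMascheroniConstant r w = 0 ↔ RiemannHypothesis := by
  have hlim := tendsto_integral_div_sq_add_sq measurable_boundaryLog hr hnear' hη₀ hint
  have hpoint : ∀ η : ℝ, 0 < η → η < r → quadrantZeta 0 (1 / 4 + η * Complex.I) ≠ 0 ∧
      |Real.log ‖quadrantZeta 0 (1 / 4 + η * Complex.I)‖| ≤ C * η ^ 2 := by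
    intro η hη hηr
    have h1 : ‖(η * Complex.I : ℂ)‖ = η := by
      rw [norm_mul, Complex.norm_I, mul_one, Complex.norm_real, Real.norm_eq_abs, abs_of_pos hη]
    have := hnear (η * Complex.I) (by rwa [h1])
    rw [h1] at this
    simpa using this
  have hsmall : Tendsto (fun η : ℝ => Real.pi * C * η) (𝓝[>] 0) (𝓝 0) := by
    have : ContinuousAt (fun η : ℝ => Real.pi * C * η) 0 := by fun_prop
    simpa using this.tendsto.mono_left (nhdsWithin_le_nhds (s := Ioi 0))
  constructor
  · intro hT
    by_contra hRH
    obtain ⟨s, hsre, hsim, hs⟩ := exists_zero_of_not_riemannHypothesis hRH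
    set q : ℂ := (s - 1 / 2) ^ 2 with hq
    have hqim : 0 < q.im := by
      have : q.im = 2 * (s.re - 1 / 2) * s.im := by
        simp [hq, pow_two]
        ring
      rw [this]
      have : 0 < s.re - 1 / 2 := by linarith
      positivity
    have hq0 : quadrantZeta 0 q = 0 := by
      rw [quadrantZeta, upperSqrt_of_sq_eq (w := s - 1 / 2) hqim.le rfl (by simp; linarith)
        (by simpa using hsim.le)]
      simpa using hs
    set D : ℝ := 2 * q.im / ((q.re - 1 / 4) ^ 2 + (q.im + 1) ^ 2) with hD
    have hD0 : 0 < D := by positivity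
    have hle : ∀ᶠ η : ℝ in 𝓝[>] 0, Real.pi * D - Real.pi * C * η
        ≤ ∫ w, boundaryLog w / (w ^ 2 + η ^ 2) := by
      -- The zero contributes at least `D η` and `log |F(p)| ≥ -C η²`. After division by `η`, the
      -- integral is at least `π D - π C η`, whose limit is positive.
      filter_upwards [Ioo_mem_nhdsGT (show (0 : ℝ) < min r 1 by positivity)] with η hη
      obtain ⟨h1, h2⟩ := hpoint η hη.1 (hη.2.trans_le (min_le_left _ _))
      have h3 := log_norm_add_le_integral_boundaryLog hη.1 h1 hqim hq0
      have h4 := le_log_norm_inv hqim hη.1 (hη.2.trans_le (min_le_right _ _)).le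
        (fun h => h1 (h ▸ hq0))
      rw [← hD] at h4
      have h5 := (abs_le.1 h2).1
      rw [← div_eq_inv_mul, le_div_iff₀ Real.pi_pos] at h3
      have h6 : (D * η - C * η ^ 2) * Real.pi
          ≤ η * ∫ w, boundaryLog w / (w ^ 2 + η ^ 2) :=
        le_trans (mul_le_mul_of_nonneg_right (by linarith) Real.pi_pos.le) h3
      refine le_of_mul_le_mul_left ?_ hη.1
      linarith
    have := le_of_tendsto_of_tendsto (hsmall.const_sub (Real.pi * D)) hlim hle
    rw [hT, sub_zero] at this
    have : 0 < Real.pi * D := by positivity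
    linarith
  · intro hRH
    have hZ : ∀ s : ℂ, 1 / 2 < s.re → riemannZeta₁ s ≠ 0 := fun s hs =>
      riemannZeta₁_ne_zero_of_riemannHypothesis hRH hs
    -- Without zeros the integral is exactly `π log |F(p)| / η = O(η)`.
    refine tendsto_nhds_unique hlim (squeeze_zero_norm' ?_ hsmall)
    filter_upwards [Ioo_mem_nhdsGT hr] with η hη
    have h2 := (hpoint η hη.1 hη.2).2
    rw [log_norm_eq_integral_boundaryLog hZ hη.1, abs_mul, abs_mul,
      abs_of_pos (inv_pos.2 Real.pi_pos), abs_of_pos hη.1, ← div_eq_inv_mul,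
      div_le_iff₀ Real.pi_pos] at h2
    rw [Real.norm_eq_abs]
    refine le_of_mul_le_mul_left ?_ hη.1
    linarith

theorem mainTheorem5 :
    IntegrableOn criticalLineIntegrand (Ioi 0) ∧
      ∃ P : ℝ, HasPrincipalValueIoi realAxisIntegrand (1 / 2) 1 P ∧
        (-(∫ t in Ioi (0 : ℝ), criticalLineIntegrand t) = P ↔ RiemannHypothesis) := by
  obtain ⟨C, r, hr, hr1, hnear⟩ := exists_log_norm_quadrantZeta_near
  set γ : ℝ := Real.eulerMascheroniConstant with hγ
  have hnear' : ∀ w ∈ Ioo (-r) r, |boundaryLog w - γ * w| ≤ C * w ^ 2 := by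
    intro w hw
    have h1 : ‖(w : ℂ)‖ = |w| := by rw [Complex.norm_real, Real.norm_eq_abs]
    have h2 := (hnear w (by rw [h1]; exact abs_lt.2 hw)).2
    rw [h1, sq_abs, Complex.ofReal_re] at h2
    have h3 : boundaryLog w = Real.log ‖quadrantZeta 0 (1 / 4 + w)‖ := by
      rw [boundaryLog]
      push_cast
      rfl
    rwa [h3]
  have hη₀ : 0 < r / 2 := by positivity
  have hint : Integrable fun w => boundaryLog w / (w ^ 2 + (r / 2) ^ 2) := by
    refine integrable_boundaryLog hη₀ (hnear _ ?_).1
    rw [norm_mul, Complex.norm_I, mul_one, Complex.norm_real, Real.norm_eq_abs, abs_of_pos hη₀]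
    linarith
  have hΦ := integrable_poleRemoved measurable_boundaryLog hr hnear' hη₀ hint
  have hiff := integral_poleRemoved_eq_zero_iff hr hnear hη₀ hint hnear'
  rw [← hγ] at hiff
  have hleft : ∀ w ∈ Iio (-1 / 4 : ℝ), 1 / 4 ≤ |w| := fun w hw => by
    have hw' : w < -1 / 4 := hw
    rw [abs_of_neg (by linarith)]
    linarith
  have hIint := integrableOn_div_sq (by norm_num) measurableSet_Iio hleft hΦ
  have hIeq := setIntegral_div_sq (by norm_num) measurableSet_Iio hleft hΦ
  -- The pole correction lives in `|w| < r ≤ 1/8`, away from the critical-line part, so `I` is half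
  -- the integral of `poleRemoved` over `w < -1/4`.
  have hempty : Iio (-1 / 4 : ℝ) ∩ Ioo (-r) r = ∅ := by
    ext w
    simp only [mem_inter_iff, mem_Iio, mem_Ioo, mem_empty_iff_false, iff_false]
    rintro ⟨h1, h2, -⟩
    linarith
  rw [hempty, setIntegral_empty, mul_zero, add_zero, ← image_neg_sq_sub_Ioi,
    integral_image_eq_integral_abs_deriv_smul measurableSet_Ioi
      (fun t _ => hasDerivWithinAt_neg_sq_sub t _) injOn_neg_sq_sub,
    setIntegral_congr_fun measurableSet_Ioi fun t ht => criticalLineIntegrand_eq ht,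
    integral_const_mul, image_neg_sq_sub_Ioi] at hIeq
  rw [← image_neg_sq_sub_Ioi, integrableOn_image_iff_integrableOn_abs_deriv_smul measurableSet_Ioi
      (fun t _ => hasDerivWithinAt_neg_sq_sub t _) injOn_neg_sq_sub] at hIint
  refine ⟨?_, 1 / 2 * ∫ w in Ioi (-1 / 4), poleRemoved boundaryLog γ r w, ⟨fun ε hε => ⟨?_, ?_⟩, ?_⟩,
    ?_⟩
  · refine IntegrableOn.congr_fun (hIint.const_mul (1 / 2)) (fun t ht => ?_) measurableSet_Ioi
    simp only [criticalLineIntegrand_eq ht]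
    ring
  -- For `ε ≥ 1/2` the left interval is empty.
  · rcases le_or_gt (1 / 2) ε with h | h
    · rw [Ioo_eq_empty (by linarith)]
      exact integrableOn_empty
    · refine integrableOn_realAxisIntegrand measurableSet_Ioo
        (fun x hx => ⟨hx.1, by linarith [hx.2]⟩) ?_
      rw [image_mul_sub_one_Ioo (by linarith)]
      refine integrableOn_div_sq (a := ε - ε ^ 2) (by nlinarith) measurableSet_Ioo (fun w hw => ?_) hΦ
      have h1 : w < -(ε - ε ^ 2) := by linarith [hw.2]
      rw [abs_of_neg (by nlinarith)]
      linarith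
  · refine integrableOn_realAxisIntegrand measurableSet_Ioi (fun x hx => ?_) ?_
    · have hx' : 1 + ε < x := hx
      exact ⟨by linarith, by linarith⟩
    rw [image_mul_sub_one_Ioi (by linarith)]
    refine integrableOn_div_sq (a := ε + ε ^ 2) (by positivity) measurableSet_Ioi (fun w hw => ?_) hΦ
    have h1 : (1 + ε) * (1 + ε - 1) < w := hw
    exact le_trans (by linarith) (le_abs_self w)
  · refine ((tendsto_principalValue_div_sq hr hr1 hΦ).const_mul (1 / 2)).congr' ?_
    filter_upwards [Ioo_mem_nhdsGT (show (0 : ℝ) < 1 / 2 by norm_num)] with ε hε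
    rw [setIntegral_realAxisIntegrand measurableSet_Ioo
        (fun x hx => ⟨hx.1, by linarith [hx.2, hε.1]⟩),
      setIntegral_realAxisIntegrand measurableSet_Ioi (fun x hx => ?_),
      image_mul_sub_one_Ioo (by linarith [hε.2]), image_mul_sub_one_Ioi (by linarith [hε.1]),
      show (1 - ε) * (1 - ε - 1) = -(ε - ε ^ 2) by ring,
      show (1 + ε) * (1 + ε - 1) = ε + ε ^ 2 by ring]
    · ring
    · have hx' : 1 + ε < x := hx
      exact ⟨by linarith [hε.1], by linarith [hε.1]⟩
  -- The two halves add up to `I + P = (1/2) ∫ poleRemoved` over the whole line.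
  · rw [← hiff, ← intervalIntegral.integral_Iio_add_Ici hΦ.integrableOn hΦ.integrableOn,
      integral_Ici_eq_integral_Ioi, ← hIeq]
    constructor <;> intro h <;> linarith
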